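/- For $n\in\mathbb N$ write $[n]=\{1,\dots,n\}$, and for $p\in[0,1]$ let $[n]_p$ be the random subset of $[n]$ containing each element of $[n]$ independently with probability $p$. A set $A\subseteq\mathbb N$ is *product-Schur* if for every colouring of the elements of $A$ with two colours there are $a,b,c\in A$ of the same colour with $ab=c$ (where $a=b$ is allowed). Let $D(n)$ be the maximum, over $1\le i\le n$, of the number of divisors of $i$. **Theorem.** Let $p=p(n)\in[0,1]$. (0) If $p(n)\le n^{-1/9}D(n)^{-100}$ for all sufficiently large $n$, then $\lim_{n\to\infty}\Pr([n]_p\text{ is product-Schur})=0$. Moreover, there is a function $\varepsilon(n)\to0$, independent of $p$, such that $n^{-1/9}D(n)^{-100}=n^{-1/9-\varepsilon(n)}$ for all $n\ge1$; so the same conclusion holds whenever $p(n)\le n^{-1/9-\varepsilon(n)}$ for all sufficiently large $n$. (1) If $p(n)=\omega(n^{-1/11})$, that is, $p(n)/n^{-1/11}\to\infty$ as $n\to\infty$, then $\lim_{n\to\infty}\Pr([n]_p\text{ is product-Schur})=1$. In fact, with probability tending to $1$, every colouring of $[n]_p$ with two colours admits $a,b,c\in[n]_p$ of the same colour with $ab=c$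 and $a\ne b$. -/

import Mathlib

open Filter Topology ProbabilityTheory

/-- A set `A` of natural numbers is `r`-product-Schur if every colouring of the elements of `A`
with `r` colours yields monochromatic `a, b, c ∈ A` with `a * b = c` (possibly `a = b`). -/
def IsProductSchurWith (r : ℕ) (A : Set ℕ) : Prop :=
  ∀ χ : A → Fin r, ∃ a b c : A, (a : ℕ) * b = c ∧ χ a = χ b ∧ χ b = χ c

/-- Product-Schur: the case of two colours. -/
def IsProductSchur (A : Set ℕ) : Prop :=
  IsProductSchurWith 2 A

/-- The non-degenerate variant, for two colours: the two factors are required to be distinct. -/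
def IsNondegProductSchur (A : Set ℕ) : Prop :=
  ∀ χ : A → Fin 2, ∃ a b c : A, (a : ℕ) * b = c ∧ a ≠ b ∧ χ a = χ b ∧ χ b = χ c

/-- `maxDivisors n` is `D(n)`, the maximum over `1 ≤ i ≤ n` of the number of divisors of `i`. -/
def maxDivisors (n : ℕ) : ℕ :=
  (Finset.Icc 1 n).sup fun i => i.divisors.card

/-- `probRandomSubset n p 𝒜` is the probability that the binomial random subset `[n]_p` of
`[n] = {1, …, n}`, which contains each element of `[n]` independently with probability `p`,
has the property `𝒜`. -/
noncomputable def probRandomSubset (n : ℕ) (p : unitInterval) (𝒜 : Set ℕ → Prop) : ℝ :=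
  (setBernoulli (Set.Icc 1 n) p).real {S | 𝒜 S}

/-! 0-statement. Colour an element of `A` blue if it is a product of two elements of `A` but not of
two blue ones, and red otherwise; no triple is entirely blue. In a red triple `a * b = c`, the
element `c` is also a product of two blue elements, `u * v` and `u' * v'`. Generically this puts
nine elements of `A` among the divisors of one `c ≤ n`: `c`, `a`, `b`, `u * v`, `u' * v'`, `u`, `v`,
`u'`, `v'`. The expected number of such configurations is `n ^ (1 + o(1)) * p ^ 9`, hence the
exponent 1/9.

Coincidences leave fewer elements, but repeated factors also leave fewer choices for `c`.
`IsDivisorSparse` records this trade-off for every `j ≤ 9`. A union bound shows that it holds with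
high probability, and `IsDivisorSparse.card_add_card_le` turns it into the inequality that rules out
every red triple (`false_of_red_of_blue`, with `false_of_nested` and `false_of_shared` for the
coincidences).

1-statement. Given `a`, `b`, `a * b` in the set, five multiples of some `c` force `a` and `b` to
have different colours, and six multiples of some `d` force equal colours. Take `b ∼ N`, `a ∼ N ^
2`, `c ∼ N ^ 5`, `d ∼ N ^ 6`: the exponent is each time the number of elements the new choice must
bring into the set, so a search succeeds on average about `(p * N) ^ k` times. The largest element
is of order `N ^ 11`, so `N ∼ n ^ (1/11)` and `p * N → ∞` suffices. -/

/-- `A ⊆ [n]`, and for `j ≤ 9` and `m ≤ n ^ (j / 9)` fewer than `j` elements of `A` divide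
`m ^ 9`. -/
structure IsDivisorSparse (n : ℕ) (A : Set ℕ) : Prop where
  subset : A ⊆ Set.Icc 1 n
  card_lt : ∀ j ∈ Finset.Icc 1 9, ∀ m : ℕ, 1 ≤ m → m ^ 9 ≤ n ^ j →
    ∀ S : Finset ℕ, ↑S ⊆ A → (∀ x ∈ S, x ∣ m ^ 9) → S.card < j

/-! ### Products of multisets of natural numbers. -/

theorem Multiset.prod_dvd_pow_card {M : Multiset ℕ} {m : ℕ} (h : ∀ x ∈ M, x ∣ m) :
    M.prod ∣ m ^ M.card := by
  induction M using Multiset.induction_on with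
  | empty => simp
  | cons a s ih =>
    rw [Multiset.prod_cons, Multiset.card_cons, pow_succ']
    exact mul_dvd_mul (h a (by simp)) (ih fun x hx => h x (by simp [hx]))

theorem Multiset.pow_card_le_prod_pow {M : Multiset ℕ} {n k : ℕ} (h : ∀ x ∈ M, n ≤ x ^ k) :
    n ^ M.card ≤ M.prod ^ k := by
  induction M using Multiset.induction_on with
  | empty => simp
  | cons a s ih =>
    rw [Multiset.prod_cons, Multiset.card_cons, pow_succ', mul_pow]
    exact Nat.mul_le_mul (h a (by simp)) (ih fun x hx => h x (by simp [hx]))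

/-- Two distinct members of a multiset with at least three members, all `≥ 2`, have product
smaller than the product of the multiset. -/
theorem Multiset.mul_lt_prod {M : Multiset ℕ} (hM : ∀ x ∈ M, 2 ≤ x) (hc : 3 ≤ M.card) {a b : ℕ}
    (ha : a ∈ M) (hb : b ∈ M) (hab : a ≠ b) : a * b < M.prod := by
  obtain ⟨R, rfl⟩ := Multiset.exists_cons_of_mem ha
  have hb' : b ∈ R := by simpa [hab.symm] using hb
  obtain ⟨T, rfl⟩ := Multiset.exists_cons_of_mem hb'
  obtain ⟨x, hx⟩ : ∃ x, x ∈ T := by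
    refine Multiset.card_pos_iff_exists_mem.1 ?_
    simp at hc; omega
  obtain ⟨Q, rfl⟩ := Multiset.exists_cons_of_mem hx
  have h1 : 0 < Q.prod := by
    refine Multiset.prod_pos fun y hy => ?_
    have := hM y (by simp [hy])
    lia
  have h2 := hM x (by simp)
  have h3 := hM a (by simp)
  have h4 := hM b (by simp)
  simp only [Multiset.prod_cons]
  have h5 : 2 * 1 ≤ x * Q.prod := Nat.mul_le_mul h2 h1
  have h6 : 0 < a * b := by positivity
  nlinarith

/-! ### Counting divisors inside a divisor-sparse set. -/

namespace IsDivisorSparse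

variable {n : ℕ} {A : Set ℕ}

/-- The case `j = 1` with `m = x`, since `x ∣ x ^ 9`. -/
theorem pow_gt (h : IsDivisorSparse n A) {x : ℕ} (hx : x ∈ A) : n < x ^ 9 := by
  by_contra! hle
  have := h.card_lt 1 (by simp) x (h.subset hx).1 (by simpa using hle) {x} (by simpa using hx)
    (by simp)
  simp at this

theorem two_le (h : IsDivisorSparse n A) {x : ℕ} (hx : x ∈ A) : 2 ≤ x := by
  have h1 := h.subset hx
  have h2 := h.pow_gt hx
  by_contra! hlt
  have : x = 1 := le_antisymm (by omega) h1.1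
  subst this
  have := h1.2
  omega

/-- Each repeated factor of `M` exceeds `n ^ (1/9)`, so with `E` the repetitions, the product `m` of
the distinct factors is at most `n ^ ((9 - E.card) / 9)`. As `M.prod ∣ m ^ 9`, sparsity with `j = 9
- E.card` bounds `S`. Every repetition in `M` thus lowers by one the number of divisors allowed. -/
theorem card_add_card_le (h : IsDivisorSparse n A) {M : Multiset ℕ} (hM : ∀ x ∈ M, x ∈ A)
    (h0 : M ≠ 0) (h9 : M.card ≤ 9) (hn : M.prod ≤ n) {S : Finset ℕ} (hS : ↑S ⊆ A)
    (hd : ∀ x ∈ S, x ∣ M.prod) : S.card + M.card ≤ 8 + M.toFinset.card := by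
  have hE : M.dedup + (M - M.dedup) = M := add_tsub_cancel_of_le (Multiset.dedup_le M)
  set E := M - M.dedup
  set m := M.dedup.prod
  have hk : M.toFinset.card = M.dedup.card := Multiset.card_toFinset M
  have hcard : M.dedup.card + E.card = M.card := by
    conv_rhs => rw [← hE, Multiset.card_add]
  have hprod : m * E.prod = M.prod := by
    conv_rhs => rw [← hE, Multiset.prod_add]
  have hk1 : 1 ≤ M.dedup.card := by
    rw [← hk, Nat.one_le_iff_ne_zero, Ne, Finset.card_eq_zero, Multiset.toFinset_eq_empty]
    exact h0
  have hm1 : 0 < m := by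
    refine Multiset.prod_pos fun y hy => ?_
    have := h.two_le (hM y (Multiset.mem_dedup.1 hy))
    lia
  have hEn : n ^ E.card ≤ E.prod ^ 9 := Multiset.pow_card_le_prod_pow fun x hx =>
    (h.pow_gt (hM x (by rw [← hE]; simp [hx]))).le
  have hn0 : 0 < n := by
    have : 0 < M.prod := Multiset.prod_pos fun y hy => by
      have := h.two_le (hM y hy)
      lia
    lia
  have hle : m ^ 9 ≤ n ^ (9 - E.card) := by
    have h1 : m ^ 9 * n ^ E.card ≤ n ^ (9 - E.card) * n ^ E.card := by
      rw [← pow_add, Nat.sub_add_cancel (by lia)]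
      calc m ^ 9 * n ^ E.card ≤ m ^ 9 * E.prod ^ 9 := Nat.mul_le_mul_left _ hEn
        _ = M.prod ^ 9 := by rw [← hprod, mul_pow]
        _ ≤ n ^ 9 := Nat.pow_le_pow_left hn 9
    exact Nat.le_of_mul_le_mul_right h1 (by positivity)
  have hdm : M.prod ∣ m ^ 9 := by
    refine (Multiset.prod_dvd_pow_card (m := m) fun x hx => ?_).trans (pow_dvd_pow m h9)
    exact Multiset.dvd_prod (Multiset.mem_dedup.2 hx)
  have := h.card_lt (9 - E.card) (by simp; lia) m hm1 hle S hS fun x hx => (hd x hx).trans hdm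
  lia

/-- If the elements of `M` generate `c` and lie in a set `G` too small compared with the set `W`
of divisors of `c`, we have a contradiction. -/
theorem false_of_subset (h : IsDivisorSparse n A) {W G : Finset ℕ} (hW : ↑W ⊆ A) (hG : ↑G ⊆ A)
    {c : ℕ} (hc : c ≤ n) (hWc : ∀ x ∈ W, x ∣ c) {M : Multiset ℕ} (hM : ∀ x ∈ M, x ∈ G)
    (hMc : M.prod = c) (hM9 : M.card ≤ 9) (h0 : M ≠ 0) (hlt : 8 + G.card < W.card + M.card) :
    False := by
  have h1 := h.card_add_card_le (M := M) (fun x hx => hG (hM x hx)) h0 hM9 (hMc ▸ hc) hW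
    (hMc ▸ hWc)
  have h2 : M.toFinset.card ≤ G.card := Finset.card_le_card fun x hx => hM x (by simpa using hx)
  lia

theorem lt_mul_left (h : IsDivisorSparse n A) {a b : ℕ} (ha : a ∈ A) (hb : b ∈ A) :
    a < a * b := by
  have := h.two_le ha
  have := h.two_le hb
  nlinarith

theorem lt_mul_right (h : IsDivisorSparse n A) {a b : ℕ} (ha : a ∈ A) (hb : b ∈ A) :
    b < a * b := by
  have := h.two_le ha
  have := h.two_le hb
  nlinarith

/-- A square `a * a` in `A` has no factorization in `A` whose smaller factor is a product. -/
theorem mul_self_ne (h : IsDivisorSparse n A) {a a' u v : ℕ} (hc : a * a ∈ A) (ha : a ∈ A)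
    (ha' : a' ∈ A) (hb' : u * v ∈ A) (hu : u ∈ A) (hv : v ∈ A) (hlt : u * v < a) :
    a' * (u * v) ≠ a * a := by
  intro he
  have hcn := (h.subset hc).2
  have hle : a ^ 9 ≤ n ^ 5 := by
    have h1 : (a ^ 9) ^ 2 ≤ (n ^ 5) ^ 2 := by
      calc (a ^ 9) ^ 2 = (a * a) ^ 9 := by ring
        _ ≤ n ^ 9 := Nat.pow_le_pow_left hcn 9
        _ ≤ n ^ 10 := Nat.pow_le_pow_right (by have := (h.subset hc).1; lia) (by norm_num)
        _ = (n ^ 5) ^ 2 := by ring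
    exact (Nat.pow_le_pow_iff_left two_ne_zero).1 h1
  have h2 := h.two_le ha
  have h3 := h.lt_mul_left hu hv
  have h4 : a < a' := by
    by_contra! hge
    have : a' * (u * v) ≤ a * (u * v) := Nat.mul_le_mul_right _ hge
    nlinarith
  have h5 := h.lt_mul_left ha' hb'
  -- Here `a ≤ n ^ (1/2) ≤ n ^ (5/9)`, so `a ^ 9` has at most four divisors in `A`; but `u < u * v <
  -- a < a' < a * a` are five.
  have := h.card_lt 5 (by simp) a (by lia) hle {a * a, a, a', u * v, u} (by
      simp [Set.insert_subset_iff, *]) (by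
      have hd : a * a ∣ a ^ 9 := ⟨a ^ 7, by ring⟩
      have h6 : a' ∣ a ^ 9 := (Dvd.intro _ he).trans hd
      have h7 : u * v ∣ a ^ 9 := (Dvd.intro_left _ he).trans hd
      simp only [Finset.mem_insert, Finset.mem_singleton]
      rintro x (rfl | rfl | rfl | rfl | rfl)
      exacts [hd, ⟨x ^ 8, by ring⟩, h6, h7, (Dvd.intro _ rfl).trans h7])
  rw [Finset.card_insert_of_notMem, Finset.card_insert_of_notMem, Finset.card_insert_of_notMem,
    Finset.card_insert_of_notMem, Finset.card_singleton] at this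
  · lia
  all_goals simp; lia

/-- The square of a product `u * v` has no factorization in `A` into two different factors. -/
theorem mul_ne_mul_self (h : IsDivisorSparse n A) {a b u v : ℕ} (hc : a * b ∈ A) (ha : a ∈ A)
    (hb : b ∈ A) (ha' : u * v ∈ A) (hu : u ∈ A) (hv : v ∈ A) (hab : a < b) :
    a * b ≠ (u * v) * (u * v) := by
  intro he
  obtain ⟨d, hd⟩ : ∃ d, d = u * v := ⟨_, rfl⟩
  rw [← hd] at he ha'
  have hcn := (h.subset hc).2
  have h1n : 1 ≤ n := (h.subset hc).1.trans hcn
  have h2 := h.two_le ha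
  have had : a < d := by nlinarith
  have hdb : d < b := by nlinarith
  have hbc := h.lt_mul_right ha hb
  have hle : d ^ 9 ≤ n ^ 5 := by
    have h1 : (d ^ 9) ^ 2 ≤ (n ^ 5) ^ 2 := by
      calc (d ^ 9) ^ 2 = (a * b) ^ 9 := by rw [he]; ring
        _ ≤ n ^ 9 := Nat.pow_le_pow_left hcn 9
        _ ≤ n ^ 10 := Nat.pow_le_pow_right h1n (by norm_num)
        _ = (n ^ 5) ^ 2 := by ring
    exact (Nat.pow_le_pow_iff_left two_ne_zero).1 h1
  have hda : a * b ∣ d ^ 9 := ⟨d ^ 7, by rw [he]; ring⟩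
  -- The divisors `a < d < b < a * b` already exhaust the four allowed for `d ^ 9`. This forces `u =
  -- v = a`, so `d = a ^ 2`, `b = a ^ 3`, and `b ≤ n` brings the case `j = 3` into play.
  have key : ∀ w ∈ A, w ∣ d → w < d → w = a := by
    intro w hw hwd hwlt
    by_contra hne
    have := h.card_lt 5 (by simp) d (by lia) hle {a * b, b, d, a, w} (by
        simp [Set.insert_subset_iff, hc, hb, ha', ha, hw]) (by
        simp only [Finset.mem_insert, Finset.mem_singleton]
        rintro x (rfl | rfl | rfl | rfl | rfl)
        exacts [hda, (Dvd.intro_left _ rfl).trans hda, ⟨x ^ 8, by ring⟩,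
          (Dvd.intro _ rfl).trans hda, hwd.trans ⟨d ^ 8, by ring⟩])
    rw [Finset.card_insert_of_notMem, Finset.card_insert_of_notMem, Finset.card_insert_of_notMem,
      Finset.card_insert_of_notMem, Finset.card_singleton] at this
    · lia
    all_goals simp; lia
  have hua := key u hu (Dvd.intro _ hd.symm) (hd ▸ h.lt_mul_left hu hv)
  have hva := key v hv (Dvd.intro_left _ hd.symm) (hd ▸ h.lt_mul_right hu hv)
  rw [hua, hva] at hd
  have hb3 : b = a ^ 3 := by
    refine Nat.eq_of_mul_eq_mul_left (show 0 < a by lia) ?_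
    rw [he, hd]
    ring
  have hle' : a ^ 9 ≤ n ^ 3 := by
    calc a ^ 9 = b ^ 3 := by rw [hb3]; ring
      _ ≤ n ^ 3 := Nat.pow_le_pow_left (h.subset hb).2 3
  have := h.card_lt 3 (by simp) a (by lia) hle' {a * b, b, a} (by
      simp [Set.insert_subset_iff, hc, ha, hb]) (by
      simp only [Finset.mem_insert, Finset.mem_singleton]
      rintro x (rfl | rfl | rfl)
      exacts [⟨a ^ 5, by rw [hb3]; ring⟩, ⟨a ^ 6, by rw [hb3]; ring⟩, ⟨x ^ 8, by ring⟩])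
  rw [Finset.card_insert_of_notMem, Finset.card_insert_of_notMem, Finset.card_singleton] at this
  · lia
  all_goals simp; lia

end IsDivisorSparse

/-! ### Coincidences between two factorizations of one element. -/

namespace IsDivisorSparse

variable {n : ℕ} {A : Set ℕ}

/-- There are no two factorizations `a * b = (b' * w) * b'` into four different factors in which
the factor `b'` is itself a product of two elements of `A`. -/
theorem false_of_nested (h : IsDivisorSparse n A) {a b b' u v w : ℕ} (hc : a * b ∈ A) (ha : a ∈ A)
    (hb : b ∈ A) (ha' : b' * w ∈ A) (hb' : b' ∈ A) (hu : u ∈ A) (hv : v ∈ A) (hw : w ∈ A)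
    (hab : a ≠ b) (haa : a ≠ b' * w) (hab' : a ≠ b') (hba : b ≠ b' * w) (hbb : b ≠ b')
    (huv : u * v = b') (he : b' * w * b' = a * b) : False := by
  have ac := h.lt_mul_left ha hb
  have bc := h.lt_mul_right ha hb
  have a'c := h.lt_mul_left ha' hb'
  have b'a' := h.lt_mul_left hb' hw
  have wa' := h.lt_mul_right hb' hw
  have ub' := h.lt_mul_left hu hv
  have vb' := h.lt_mul_right hu hv
  rw [huv] at ub' vb'
  rw [he] at a'c
  have hcn := (h.subset hc).2
  have hdvd : ∀ x ∈ ({a * b, b' * w, b', a, b} : Finset ℕ), x ∣ a * b := by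
    simp only [Finset.mem_insert, Finset.mem_singleton]
    rintro x (rfl | rfl | rfl | rfl | rfl)
    exacts [dvd_rfl, ⟨b', he.symm⟩, ⟨x * w, by rw [← he]; ring⟩, ⟨b, rfl⟩, ⟨a, by ring⟩]
  have hsub : ↑({a * b, b' * w, b', a, b} : Finset ℕ) ⊆ A := by
    simp [Set.insert_subset_iff, *]
  have hcard : ({a * b, b' * w, b', a, b} : Finset ℕ).card = 5 := by
    rw [Finset.card_insert_of_notMem, Finset.card_insert_of_notMem, Finset.card_insert_of_notMem,
      Finset.card_insert_of_notMem, Finset.card_singleton]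
    all_goals simp; lia
  -- If `w = b'`, then `b'` is not a new divisor beside the factors; but the product is `(u * v) ^
  -- 3`, whose many repetitions compensate.
  by_cases hwb : w = b'
  · subst hwb
    refine h.false_of_subset (G := {u, v}) hsub (by simp [Set.insert_subset_iff, *]) hcn hdvd
      (M := {u, v, u, v, u, v}) (by simp) ?_ (by simp) (by simp) ?_
    · simp [← he, ← huv]; ring
    · have : ({u, v} : Finset ℕ).card ≤ 2 := Finset.card_le_two
      rw [hcard]; simp; lia
  set M : Multiset ℕ := {u, v, u, v, w} with hM
  have hMc : M.prod = a * b := by simp [hM, ← he, ← huv]; ring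
  have hM2 : ∀ x ∈ M, x ∈ A := by simp [hM]; tauto
  have hnot : ¬ (a ∈ M ∧ b ∈ M) := fun hh => by
    have := Multiset.mul_lt_prod (fun x hx => h.two_le (hM2 x hx)) (by simp [hM]) hh.1 hh.2 hab
    lia
  -- One of `a`, `b` lies outside `M`. With `a * b`, `b' * w` and `b'` it gives four divisors beyond
  -- the distinct factors, one too many for five factors.
  have key : ∀ z, (z = a ∨ z = b) → z ∉ M → False := by
    intro z hz hzM
    have hzc : z ∣ a * b := by
      rcases hz with rfl | rfl
      exacts [⟨b, rfl⟩, ⟨a, by ring⟩]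
    have h1 := h.card_add_card_le (M := M) (S := insert (a * b) (insert (b' * w) (insert b'
      (insert z M.toFinset)))) hM2 (by simp [hM]) (by simp [hM]) (hMc ▸ hcn) ?_ ?_
    · rw [Finset.card_insert_of_notMem, Finset.card_insert_of_notMem,
        Finset.card_insert_of_notMem, Finset.card_insert_of_notMem] at h1
      · have : M.card = 5 := by simp [hM]
        lia
      · simpa using hzM
      · simp [hM]; lia
      · simp [hM]; lia
      · simp [hM]; lia
    · intro x hx
      simp only [Finset.coe_insert, Set.mem_insert_iff, Finset.mem_coe, Multiset.mem_toFinset] at hx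
      rcases hx with rfl | rfl | rfl | rfl | hx
      · exact hc
      · exact ha'
      · exact hb'
      · rcases hz with rfl | rfl <;> assumption
      · exact hM2 x hx
    · intro x hx
      rw [hMc]
      simp only [Finset.mem_insert, Multiset.mem_toFinset] at hx
      rcases hx with rfl | rfl | rfl | rfl | hx
      · exact dvd_rfl
      · exact ⟨b', he.symm⟩
      · exact ⟨x * w, by rw [← he]; ring⟩
      · exact hzc
      · exact hMc ▸ Multiset.dvd_prod hx
  by_cases haM : a ∈ M
  · exact key b (.inr rfl) fun hbM => hnot ⟨haM, hbM⟩
  · exact key a (.inl rfl) haM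

/-- The main configuration: `a * (v * b') = (a * v) * b'` with `b' = u' * v'`, where `v * b'` has a
further factorization `e * f` into elements which are products themselves. -/
theorem false_of_shared (h : IsDivisorSparse n A) {a v b b' u' v' e f : ℕ} {blue : ℕ → Prop}
    (hblue : ∀ x, blue x → ∃ y ∈ A, ∃ z ∈ A, y * z = x) (hc : a * b ∈ A) (ha : a ∈ A)
    (hb : b ∈ A) (ha' : a * v ∈ A) (hv : v ∈ A) (hb' : b' ∈ A) (hu' : u' ∈ A) (hv' : v' ∈ A)
    (hab : a ≠ b) (haa : a ≠ b') (hba : b ≠ a * v) (habn : a * v ≠ b')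
    (hvb : v ≠ b') (hu'a : u' ≠ a * v) (hv'a : v' ≠ a * v)
    (huv : u' * v' = b') (hbe : b = v * b') (ha_red : ¬ blue a) (he : e ∈ A) (hf : f ∈ A)
    (heb : blue e) (hfb : blue f) (hef : e * f = b) : False := by
  have ac := h.lt_mul_left ha hb
  have bc := h.lt_mul_right ha hb
  have aa' := h.lt_mul_left ha hv
  have va' := h.lt_mul_right ha hv
  have b'b := h.lt_mul_right hv hb'
  have vb := h.lt_mul_left hv hb'
  have u'b' := h.lt_mul_left hu' hv'
  have v'b' := h.lt_mul_right hu' hv'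
  have eb := h.lt_mul_left he hf
  have fb := h.lt_mul_right he hf
  have a'c : a * v < a * b := by
    rw [hbe]
    have := h.lt_mul_left ha' hb'
    linarith [mul_assoc a v b']
  rw [← hbe] at b'b vb
  rw [huv] at u'b' v'b'
  rw [hef] at eb fb
  have hcn := (h.subset hc).2
  set M : Multiset ℕ := {a, v, u', v'} with hM
  have hMc : M.prod = a * b := by simp [hM, hbe, ← huv]
  have hM2 : ∀ x ∈ M, x ∈ A := by simp [hM]; tauto
  have hbM : b ∉ M := fun hh => by
    have := Multiset.mul_lt_prod (fun x hx => h.two_le (hM2 x hx)) (by simp [hM])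
      (by simp [hM] : a ∈ M) hh hab
    lia
  have hbM' := hbM
  simp only [hM, Multiset.insert_eq_cons, Multiset.mem_cons, Multiset.mem_singleton,
    not_or] at hbM'
  set W : Finset ℕ := insert (a * b) (insert (a * v) (insert b' (insert b M.toFinset))) with hW
  have hWcard : W.card = 4 + M.toFinset.card := by
    rw [hW, Finset.card_insert_of_notMem, Finset.card_insert_of_notMem,
      Finset.card_insert_of_notMem, Finset.card_insert_of_notMem]
    · ring
    · simpa using hbM
    · simp [hM]; lia
    · simp [hM]; lia
    · simp [hM]; lia
  have hWA : ↑W ⊆ A := by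
    intro x hx
    simp only [hW, Finset.coe_insert, Set.mem_insert_iff, Finset.mem_coe,
      Multiset.mem_toFinset] at hx
    rcases hx with rfl | rfl | rfl | rfl | hx
    exacts [hc, ha', hb', hb, hM2 x hx]
  have hWc : ∀ x ∈ W, x ∣ a * b := by
    intro x hx
    simp only [hW, Finset.mem_insert, Multiset.mem_toFinset] at hx
    rcases hx with rfl | rfl | rfl | rfl | hx
    · exact dvd_rfl
    · exact ⟨b', by rw [hbe]; ring⟩
    · exact ⟨a * v, by rw [hbe]; ring⟩
    · exact ⟨a, by ring⟩
    · exact hMc ▸ Multiset.dvd_prod hx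
  -- The counting inequality is an equality for `W` and the four factors in `M`. So `W` contains
  -- every divisor of `a * b` in `A`, and, by `gen`, the product cannot be rewritten with five to
  -- nine factors from `M`.
  have mem_W : ∀ x ∈ A, x ∣ a * b → x ∈ W := by
    intro x hx hxc
    by_contra hxW
    have h1 := h.card_add_card_le (M := M) (S := insert x W) hM2 (by simp [hM]) (by simp [hM])
      (hMc ▸ hcn) (by simp [Set.insert_subset_iff, hx, hWA]) (by
        rw [hMc]
        intro y hy
        rcases Finset.mem_insert.1 hy with rfl | hy
        exacts [hxc, hWc y hy])
    rw [Finset.card_insert_of_notMem hxW, hWcard] at h1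
    have : M.card = 4 := by simp [hM]
    lia
  have gen : ∀ N : Multiset ℕ, (∀ x ∈ N, x ∈ M) → N.prod = a * b → 5 ≤ N.card → N.card ≤ 9 →
      False := by
    intro N hN hNc h5 h9
    refine h.false_of_subset hWA (G := M.toFinset) (fun x hx => hM2 x (by simpa using hx)) hcn hWc
      (fun x hx => by simpa using hN x hx) hNc h9 ?_ (by lia)
    rintro rfl
    simp at h5
  have small : ∀ x ∈ A, x ∣ a * b → x < b → x = a * v ∨ x = b' ∨ x ∈ M := by
    intro x hx hxc hxb
    have := mem_W x hx hxc
    simp only [hW, Finset.mem_insert, Multiset.mem_toFinset] at this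
    rcases this with rfl | hh | hh | rfl | hh
    · lia
    · exact .inl hh
    · exact .inr (.inl hh)
    · lia
    · exact .inr (.inr hh)
  have hMiff : ∀ x, x ∈ M ↔ x = a ∨ x = v ∨ x = u' ∨ x = v' := by simp [hM]
  -- the factors `v`, `u'`, `v'` are not products
  have hvred : ∀ y ∈ A, ∀ z ∈ A, y * z ≠ v := by
    intro y hy z hz hyz
    have hyv := h.lt_mul_left hy hz
    have hzv := h.lt_mul_right hy hz
    rw [hyz] at hyv hzv
    have hvc : v ∣ a * b := hMc ▸ Multiset.dvd_prod (by simp [hM])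
    have hy1 := small y hy ((Dvd.intro _ hyz).trans hvc) (by lia)
    have hz1 := small z hz ((Dvd.intro_left _ hyz).trans hvc) (by lia)
    rcases hy1 with hy1 | rfl | hy1
    · lia
    · rcases hz1 with hz1 | rfl | hz1
      · lia
      · refine gen {a, u', v', u', v', u', v'} (by simp [hMiff]) ?_ (by simp) (by simp)
        simp only [Multiset.insert_eq_cons, Multiset.prod_cons, Multiset.prod_singleton,
          hbe, ← hyz, ← huv]
        ring
      · refine gen {a, u', v', u', v', z} (by simpa [hMiff] using hz1) ?_ (by simp) (by simp)
        simp only [Multiset.insert_eq_cons, Multiset.prod_cons, Multiset.prod_singleton,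
          hbe, ← hyz, ← huv]
        ring
    · rcases hz1 with hz1 | rfl | hz1
      · lia
      · refine gen {a, u', v', u', v', y} (by simpa [hMiff] using hy1) ?_ (by simp) (by simp)
        simp only [Multiset.insert_eq_cons, Multiset.prod_cons, Multiset.prod_singleton,
          hbe, ← hyz, ← huv]
        ring
      · rw [hMiff] at hy1 hz1
        refine gen {a, u', v', y, z} (by simp [hMiff, hy1, hz1]) ?_ (by simp) (by simp)
        simp only [Multiset.insert_eq_cons, Multiset.prod_cons, Multiset.prod_singleton,
          hbe, ← hyz, ← huv]
        ring
  -- For `p = u'` or `v'`, with `q` the other: splitting `p` inside `A` would lengthen the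
  -- factorization of `a * b` over `M`, against `gen`.
  have hured : ∀ p q : ℕ, (p ∈ M ∧ q ∈ M ∧ p * q = b' ∧ p < b') → ∀ y ∈ A, ∀ z ∈ A,
      y * z ≠ p := by
    rintro p q ⟨hp, hq, hpq, hpb⟩ y hy z hz hyz
    have hyp := h.lt_mul_left hy hz
    have hzp := h.lt_mul_right hy hz
    rw [hyz] at hyp hzp
    have hpc : p ∣ a * b := hMc ▸ Multiset.dvd_prod hp
    have hy1 := small y hy ((Dvd.intro _ hyz).trans hpc) (by lia)
    have hz1 := small z hz ((Dvd.intro_left _ hyz).trans hpc) (by lia)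
    rw [hMiff] at hq
    rcases hy1 with rfl | hy1 | hy1
    · rcases hz1 with rfl | hz1 | hz1
      · refine gen {a, v, a, v, a, v, q} (by simp [hMiff, hq]) ?_ (by simp) (by simp)
        simp only [Multiset.insert_eq_cons, Multiset.prod_cons, Multiset.prod_singleton,
          hbe, ← hpq, ← hyz]
        ring
      · lia
      · rw [hMiff] at hz1
        refine gen {a, v, a, v, z, q} (by simp [hMiff, hq, hz1]) ?_ (by simp) (by simp)
        simp only [Multiset.insert_eq_cons, Multiset.prod_cons, Multiset.prod_singleton,
          hbe, ← hpq, ← hyz]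
        ring
    · lia
    · rw [hMiff] at hy1
      rcases hz1 with rfl | hz1 | hz1
      · refine gen {a, v, a, v, y, q} (by simp [hMiff, hq, hy1]) ?_ (by simp) (by simp)
        simp only [Multiset.insert_eq_cons, Multiset.prod_cons, Multiset.prod_singleton,
          hbe, ← hpq, ← hyz]
        ring
      · lia
      · rw [hMiff] at hz1
        refine gen {a, v, y, z, q} (by simp [hMiff, hq, hy1, hz1]) ?_ (by simp) (by simp)
        simp only [Multiset.insert_eq_cons, Multiset.prod_cons, Multiset.prod_singleton,
          hbe, ← hpq, ← hyz]
        ring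
  have hbdvd : b ∣ a * b := ⟨a, by ring⟩
  have hblueM : ∀ x ∈ A, blue x → x ∣ b → x < b → x = a * v ∨ x = b' := by
    intro x hx hxb hxd hxlt
    obtain ⟨y, hy, z, hz, hyz⟩ := hblue x hxb
    rcases small x hx (hxd.trans hbdvd) hxlt with hh | hh | hh
    · exact .inl hh
    · exact .inr hh
    rcases (hMiff x).1 hh with rfl | rfl | rfl | rfl
    · exact absurd hxb ha_red
    · exact absurd hyz (hvred y hy z hz)
    · exact absurd hyz (hured x v' ⟨hh, by simp [hM], huv, u'b'⟩ y hy z hz)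
    · exact absurd hyz (hured x u' ⟨hh, by simp [hM], by rw [mul_comm, huv], v'b'⟩ y hy z hz)
  have hb0 := h.two_le hb'
  -- The blue factors `e`, `f` of `b` can only be `a * v` or `b'`. Two copies of `a * v` give a
  -- five-fold factorization of `a * b`; mixed choices give `a = 1`; two copies of `b'` give `v =
  -- b'`.
  rcases hblueM e he heb (Dvd.intro _ hef) eb with rfl | rfl <;>
    rcases hblueM f hf hfb (Dvd.intro_left _ hef) fb with rfl | rfl
  · refine gen {a, a, v, a, v} (by simp [hMiff]) ?_ (by simp) (by simp)
    simp only [Multiset.insert_eq_cons, Multiset.prod_cons, Multiset.prod_singleton,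
      ← hef]
    ring
  · rw [hbe] at hef
    rw [hbe] at ac bc
    nlinarith [Nat.eq_of_mul_eq_mul_right (by lia) hef]
  · rw [hbe, mul_comm] at hef
    nlinarith [Nat.eq_of_mul_eq_mul_right (by lia) hef]
  · rw [hbe] at hef
    exact hvb (Nat.eq_of_mul_eq_mul_right (by lia) hef).symm

end IsDivisorSparse

/-! ### The greedy colouring and the deterministic 0-statement. -/

/-- The colouring in which `c` is blue iff it is a product of two elements of `A`, but not of two
blue ones. -/
theorem exists_greedy_colouring (A : Set ℕ) (hA : ∀ x ∈ A, 2 ≤ x) :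
    ∃ blue : ℕ → Prop, ∀ c, blue c ↔ (∃ a ∈ A, ∃ b ∈ A, a * b = c) ∧
      ¬ ∃ a ∈ A, ∃ b ∈ A, a * b = c ∧ blue a ∧ blue b := by
  -- Well-founded recursion on size: all elements of `A` are at least 2, so factors are smaller than
  -- their product.
  let F : (c : ℕ) → ((y : ℕ) → y < c → Prop) → Prop := fun c rec =>
    (∃ a ∈ A, ∃ b ∈ A, a * b = c) ∧
      ¬ ∃ a ∈ A, ∃ b ∈ A, ∃ (ha : a < c) (hb : b < c), a * b = c ∧ rec a ha ∧ rec b hb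
  refine ⟨Nat.lt_wfRel.wf.fix F, fun c => ?_⟩
  rw [WellFounded.fix_eq]
  refine and_congr_right fun _ => not_congr ?_
  constructor
  · rintro ⟨a, ha, b, hb, _, _, h⟩
    exact ⟨a, ha, b, hb, h⟩
  · rintro ⟨a, ha, b, hb, h, h'⟩
    have := hA a ha
    have := hA b hb
    exact ⟨a, ha, b, hb, by nlinarith, by nlinarith, h, h'⟩

namespace IsDivisorSparse

variable {n : ℕ} {A : Set ℕ}

/-- A red element of `A` that is a product of two red elements is not a product of two blue
elements. -/
theorem false_of_red_of_blue (h : IsDivisorSparse n A) {blue : ℕ → Prop}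
    (hblue : ∀ c, blue c ↔ (∃ a ∈ A, ∃ b ∈ A, a * b = c) ∧
      ¬ ∃ a ∈ A, ∃ b ∈ A, a * b = c ∧ blue a ∧ blue b)
    {a b a' b' : ℕ} (hc : a * b ∈ A) (ha : a ∈ A) (hb : b ∈ A) (ha' : a' ∈ A) (hb' : b' ∈ A)
    (he : a' * b' = a * b) (har : ¬ blue a) (hbr : ¬ blue b) (hab' : blue a') (hbb' : blue b') :
    False := by
  have hprod : ∀ x, blue x → ∃ y ∈ A, ∃ z ∈ A, y * z = x := fun x hx => ((hblue x).1 hx).1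
  obtain ⟨u, hu, v, hv, rfl⟩ := hprod a' hab'
  obtain ⟨u', hu', v', hv', rfl⟩ := hprod b' hbb'
  have red_split : ∀ x y z, ¬ blue x → y ∈ A → z ∈ A → y * z = x →
      ∃ e ∈ A, ∃ f ∈ A, e * f = x ∧ blue e ∧ blue f := by
    intro x y z hx hy hz hyz
    rw [hblue] at hx
    push Not at hx
    simpa [and_assoc] using hx ⟨y, hy, z, hz, hyz⟩
  have haa : a ≠ u * v := by rintro rfl; exact har hab'
  have hba : b ≠ u * v := by rintro rfl; exact hbr hab'
  have hab2 : a ≠ u' * v' := by rintro rfl; exact har hbb'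
  have hbb2 : b ≠ u' * v' := by rintro rfl; exact hbr hbb'
  rcases eq_or_ne a b with rfl | hab
  · rcases lt_or_ge (u' * v') a with hlt | hge
    · exact h.mul_self_ne hc ha ha' hb' hu' hv' hlt he
    · have hlt : u * v < a := by
        by_contra! hle
        have : a < u * v := by lia
        have := h.two_le ha
        nlinarith
      exact h.mul_self_ne hc ha hb' ha' hu hv hlt (by rw [mul_comm, he])
  rcases eq_or_ne (u * v) (u' * v') with heq | hne
  · rw [← heq] at he
    rcases lt_or_gt_of_ne hab with hlt | hlt
    · exact h.mul_ne_mul_self hc ha hb ha' hu hv hlt he.symm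
    · exact h.mul_ne_mul_self (mul_comm a b ▸ hc) hb ha ha' hu hv hlt (by rw [mul_comm, he])
  -- a factor of one blue factor is different from the other blue factor
  have nested : ∀ u v u' v', u ∈ A → v ∈ A → u' ∈ A → v' ∈ A → u * v ∈ A → u' * v' ∈ A →
      u * v * (u' * v') = a * b → blue (u * v) → blue (u' * v') → u ≠ u' * v' := by
    rintro u v u' v' hu hv hu' hv' huv hu'v' he h1 h2 rfl
    refine h.false_of_nested hc ha hb huv hu'v' hu' hv' hv hab ?_ ?_ ?_ ?_ rfl he <;>
      rintro rfl <;> contradiction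
  have he' : u' * v' * (u * v) = a * b := by rw [mul_comm, he]
  have n1 := nested u v u' v' hu hv hu' hv' ha' hb' he hab' hbb'
  have n2 := nested v u u' v' hv hu hu' hv' (by rwa [mul_comm]) hb' (by rwa [mul_comm v])
    (by rwa [mul_comm]) hbb'
  have n3 := nested u' v' u v hu' hv' hu hv hb' ha' he' hbb' hab'
  have n4 := nested v' u' u v hv' hu' hu hv (by rwa [mul_comm]) ha' (by rwa [mul_comm v'])
    (by rwa [mul_comm]) hab'
  -- a red factor is different from all factors of the blue factors
  have shared : ∀ a b u v u' v', a * b ∈ A → a ∈ A → b ∈ A → a ≠ b → ¬ blue a → ¬ blue b →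
      u ∈ A → v ∈ A → u' ∈ A → v' ∈ A → u * v ∈ A → u' * v' ∈ A → u * v * (u' * v') = a * b →
      u * v ≠ u' * v' → blue (u * v) → blue (u' * v') → v ≠ u' * v' → u' ≠ u * v → v' ≠ u * v →
      a ≠ u := by
    rintro a b u v u' v' hc ha hb hab har hbr hu hv hu' hv' huv hu'v' he hne h1 h2 n2 n3 n4 rfl
    have hbe : b = v * (u' * v') := by
      refine Nat.eq_of_mul_eq_mul_left (by have := h.two_le ha; lia : 0 < a) ?_
      rw [← he, mul_assoc]
    -- The red `b` is the product `v * (u' * v')`, so by the colouring rule it is a product of two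
    -- blue elements. This extra factorization makes up for the coincidence `a = u`.
    obtain ⟨e, heA, f, hfA, hef, heb, hfb⟩ := red_split b v _ hbr hv hu'v' hbe.symm
    refine h.false_of_shared hprod hc ha hb huv hv hu'v' hu' hv' hab ?_ ?_ hne n2 n3 n4 rfl hbe
      har heA hfA heb hfb hef <;> rintro rfl <;> contradiction
  set M : Multiset ℕ := {u, v, u', v'} with hM
  have hM2 : ∀ x ∈ M, x ∈ A := by simp [hM]; tauto
  have hMc : M.prod = a * b := by simp [hM, ← he, mul_assoc]
  have notMem : ∀ a₁ b₁, a₁ * b₁ = a * b → a₁ ∈ A → b₁ ∈ A → a₁ ≠ b₁ → ¬ blue a₁ → ¬ blue b₁ →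
      a₁ ∉ M := by
    intro a₁ b₁ h1 ha₁ hb₁ hne₁ ha₁r hb₁r hmem
    have hc₁ : a₁ * b₁ ∈ A := h1 ▸ hc
    simp only [hM, Multiset.insert_eq_cons, Multiset.mem_cons, Multiset.mem_singleton] at hmem
    rcases hmem with hh | hh | hh | hh
    · exact shared a₁ b₁ u v u' v' hc₁ ha₁ hb₁ hne₁ ha₁r hb₁r hu hv hu' hv' ha' hb' (by rw [he, h1])
        hne hab' hbb' n2 n3 n4 hh
    · rw [mul_comm u v] at ha' he hne hab' n3 n4
      exact shared a₁ b₁ v u u' v' hc₁ ha₁ hb₁ hne₁ ha₁r hb₁r hv hu hu' hv' ha' hb' (by rw [he, h1])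
        hne hab' hbb' n1 n3 n4 hh
    · exact shared a₁ b₁ u' v' u v hc₁ ha₁ hb₁ hne₁ ha₁r hb₁r hu' hv' hu hv hb' ha'
        (by rw [he', h1]) hne.symm hbb' hab' n4 n1 n2 hh
    · rw [mul_comm u' v'] at hb' he' hne hbb' n1 n2
      exact shared a₁ b₁ v' u' u v hc₁ ha₁ hb₁ hne₁ ha₁r hb₁r hv' hu' hu hv hb' ha'
        (by rw [he', h1]) hne.symm hbb' hab' n3 n1 n2 hh
  have haM := notMem a b rfl ha hb hab har hbr
  have hbM := notMem b a (mul_comm b a) hb ha hab.symm hbr har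
  have ac := h.lt_mul_left ha hb
  have bc := h.lt_mul_right ha hb
  have a'c := h.lt_mul_left ha' hb'
  have b'c := h.lt_mul_right ha' hb'
  have ua := h.lt_mul_left hu hv
  have va := h.lt_mul_right hu hv
  have ub := h.lt_mul_left hu' hv'
  have vb := h.lt_mul_right hu' hv'
  rw [he] at a'c b'c
  -- Generic case: five divisors besides the distinct members of `M`, and four factors, make nine
  -- against the allowed eight.
  have h1 := h.card_add_card_le (M := M) (S := insert (a * b) (insert (u * v) (insert (u' * v')
    (insert a (insert b M.toFinset))))) hM2 (by simp [hM]) (by simp [hM])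
    (hMc ▸ (h.subset hc).2) ?_ ?_
  · rw [Finset.card_insert_of_notMem, Finset.card_insert_of_notMem, Finset.card_insert_of_notMem,
      Finset.card_insert_of_notMem, Finset.card_insert_of_notMem] at h1
    · have : M.card = 4 := by simp [hM]
      lia
    · simpa using hbM
    · simpa [hab] using haM
    · simp [hM]; lia
    · simp [hM]; lia
    · simp [hM]; lia
  · intro x hx
    simp only [Finset.coe_insert, Set.mem_insert_iff, Finset.mem_coe, Multiset.mem_toFinset] at hx
    rcases hx with rfl | rfl | rfl | rfl | rfl | hx
    exacts [hc, ha', hb', ha, hb, hM2 x hx]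
  · intro x hx
    rw [hMc]
    simp only [Finset.mem_insert, Multiset.mem_toFinset] at hx
    rcases hx with rfl | rfl | rfl | rfl | rfl | hx
    exacts [dvd_rfl, ⟨_, he.symm⟩, ⟨_, he'.symm⟩, ⟨_, rfl⟩, ⟨_, mul_comm _ _⟩,
      hMc ▸ Multiset.dvd_prod hx]

theorem not_isProductSchur (h : IsDivisorSparse n A) : ¬ IsProductSchur A := by
  classical
  intro hS
  obtain ⟨blue, hblue⟩ := exists_greedy_colouring A fun x hx => h.two_le hx
  obtain ⟨⟨a, ha⟩, ⟨b, hb⟩, ⟨c, hc⟩, habc, h1, h2⟩ := hS fun x => if blue x then 0 else 1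
  simp only at habc h1 h2
  subst habc
  by_cases hab : blue a
  · have hbb : blue b := by by_contra hbb; simp [hab, hbb] at h1
    have hcb : blue (a * b) := by by_contra hcb; simp [hbb, hcb] at h2
    exact ((hblue _).1 hcb).2 ⟨a, ha, b, hb, rfl, hab, hbb⟩
  · have hbb : ¬ blue b := fun hbb => by simp [hab, hbb] at h1
    have hcb : ¬ blue (a * b) := fun hcb => by simp [hbb, hcb] at h2
    have hcb' := hcb
    rw [hblue] at hcb'
    push Not at hcb'
    obtain ⟨a', ha', b', hb', he, h3, h4⟩ := hcb' ⟨a, ha, b, hb, rfl⟩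
    exact h.false_of_red_of_blue hblue hc ha hb ha' hb' he hab hbb h3 h4

end IsDivisorSparse

/-! ### Containment probabilities in the binomial random set. -/

namespace ProbabilityTheory

open MeasureTheory

variable {p : unitInterval} {u : Set ℕ}

theorem measurableSet_subset_setOf (S : Finset ℕ) : MeasurableSet {A : Set ℕ | ↑S ⊆ A} := by
  have : {A : Set ℕ | ↑S ⊆ A} = ⋂ i ∈ S, {A : Set ℕ | i ∈ A} := by
    ext A; simp [Set.subset_def]
  rw [this]
  exact Finset.measurableSet_biInter _ fun i _ => measurableSet_setOfPred.2 (measurable_set_mem i)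

theorem setBernoulli_real_superset {S : Finset ℕ} (hS : ↑S ⊆ u) :
    (setBernoulli u p).real {A | ↑S ⊆ A} = (p : ℝ) ^ S.card := by
  rw [measureReal_def, setBernoulli_apply']
  have : (fun q : ℕ → Prop => {i | q i}) ⁻¹' {A : Set ℕ | ↑S ⊆ A} =
      Set.pi ↑S fun _ => {True} := by
    ext q; simp [Set.subset_def, Set.mem_pi]
  rw [this, Measure.infinitePi_pi _ (by simp)]
  rw [Finset.prod_congr rfl (g := fun _ => (unitInterval.toNNReal p : ENNReal)), Finset.prod_const]
  · simp
  · intro i hi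
    have hi : (i ∈ u) = True := eq_true (hS hi)
    rw [hi, Measure.add_apply, Measure.smul_apply, Measure.smul_apply,
      Measure.dirac_apply' _ (by simp), Measure.dirac_apply' _ (by simp)]
    simp [ENNReal.smul_def]

theorem setBernoulli_real_superset_le (S : Finset ℕ) :
    (setBernoulli u p).real {A | ↑S ⊆ A} ≤ (p : ℝ) ^ S.card := by
  by_cases hS : ↑S ⊆ u
  · exact (setBernoulli_real_superset hS).le
  · have : (setBernoulli u p).real {A | ↑S ⊆ A} = 0 := by
      rw [measureReal_def, Measure.mono_null (t := {A | ¬ A ⊆ u}) _ setBernoulli_ae_subset]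
      · simp
      · exact fun A hA hAu => hS (hA.trans hAu)
    rw [this]
    exact pow_nonneg p.2.1 _

/-- For pairwise disjoint blocks, the events of containing a given block are independent. -/
theorem setBernoulli_real_superset_inter {ι : Type*} [DecidableEq ι] (I : Finset ι)
    (T : ι → Finset ℕ) (hTu : ∀ i ∈ I, ↑(T i) ⊆ u)
    (hT : ∀ i ∈ I, ∀ j ∈ I, i ≠ j → Disjoint (T i) (T j)) (S : Finset ℕ) (hSu : ↑S ⊆ u)
    (hS : ∀ i ∈ I, Disjoint S (T i)) :
    (setBernoulli u p).real {A | ↑S ⊆ A ∧ ∀ i ∈ I, ¬ ↑(T i) ⊆ A} =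
      (p : ℝ) ^ S.card * ∏ i ∈ I, (1 - (p : ℝ) ^ (T i).card) := by
  induction I using Finset.induction_on generalizing S with
  | empty => simpa using setBernoulli_real_superset hSu
  | insert j I hj ih =>
    have ih' := ih (fun i hi => hTu i (by simp [hi]))
      (fun i hi k hk => hT i (by simp [hi]) k (by simp [hk]))
    have h1 := ih' S hSu fun i hi => hS i (by simp [hi])
    -- Avoiding `T j` is handled by subtraction, the event of containing it being the same event for
    -- `S ∪ T j`; hence the induction over all `S`.
    have h2 := ih' (S ∪ T j) (by simp [hSu, hTu]) fun i hi => by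
      rw [Finset.disjoint_union_left]
      exact ⟨hS i (by simp [hi]), hT j (by simp) i (by simp [hi]) (by rintro rfl; exact hj hi)⟩
    rw [Finset.card_union_of_disjoint (hS j (by simp))] at h2
    have h3 := measureReal_inter_add_sdiff (μ := setBernoulli u p)
      (s := {A | ↑S ⊆ A ∧ ∀ i ∈ I, ¬ ↑(T i) ⊆ A}) (measurableSet_subset_setOf (T j))
    have e1 : {A : Set ℕ | ↑S ⊆ A ∧ ∀ i ∈ I, ¬ ↑(T i) ⊆ A} ∩ {A | ↑(T j) ⊆ A} =
        {A | ↑(S ∪ T j) ⊆ A ∧ ∀ i ∈ I, ¬ ↑(T i) ⊆ A} := by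
      ext A
      simp only [Set.mem_inter_iff, Set.mem_ofPred_eq, Finset.coe_union, Set.union_subset_iff]
      tauto
    have e2 : {A : Set ℕ | ↑S ⊆ A ∧ ∀ i ∈ I, ¬ ↑(T i) ⊆ A} \ {A | ↑(T j) ⊆ A} =
        {A | ↑S ⊆ A ∧ ∀ i ∈ insert j I, ¬ ↑(T i) ⊆ A} := by
      ext A
      simp only [Set.mem_sdiff, Set.mem_ofPred_eq, Finset.forall_mem_insert]
      tauto
    rw [e1, e2, h1, h2] at h3
    rw [Finset.prod_insert hj]
    linear_combination h3

/-- The probability that `[n]_p` contains `S`, but none of the pairwise disjoint sets `T i`. -/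
theorem setBernoulli_real_superset_inter_le {ι : Type*} [DecidableEq ι] (I : Finset ι)
    (T : ι → Finset ℕ) (hTu : ∀ i ∈ I, ↑(T i) ⊆ u)
    (hT : ∀ i ∈ I, ∀ j ∈ I, i ≠ j → Disjoint (T i) (T j)) (S : Finset ℕ) (hSu : ↑S ⊆ u)
    (hS : ∀ i ∈ I, Disjoint S (T i)) {k : ℕ} (hk : ∀ i ∈ I, (T i).card ≤ k) :
    (setBernoulli u p).real {A | ↑S ⊆ A ∧ ∀ i ∈ I, ¬ ↑(T i) ⊆ A} ≤
      (p : ℝ) ^ S.card * Real.exp (-((p : ℝ) ^ k * I.card)) := by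
  rw [setBernoulli_real_superset_inter I T hTu hT S hSu hS]
  refine mul_le_mul_of_nonneg_left ?_ (pow_nonneg p.2.1 _)
  calc ∏ i ∈ I, (1 - (p : ℝ) ^ (T i).card) ≤ ∏ i ∈ I, Real.exp (-(p : ℝ) ^ k) := by
        refine Finset.prod_le_prod (fun i _ => ?_) fun i hi => ?_
        · linarith [pow_le_one₀ (n := (T i).card) p.2.1 p.2.2]
        · have h1 : (p : ℝ) ^ k ≤ (p : ℝ) ^ (T i).card :=
            pow_le_pow_of_le_one p.2.1 p.2.2 (hk i hi)
          have h2 := Real.add_one_le_exp (-(p : ℝ) ^ k)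
          linarith
    _ = Real.exp (-((p : ℝ) ^ k * I.card)) := by
        rw [Finset.prod_const, ← Real.exp_nat_mul]
        congr 1
        ring

end ProbabilityTheory

/-! ### The divisor function -/

theorem Nat.card_divisors_pow_le (m k : ℕ) : (m ^ k).divisors.card ≤ m.divisors.card ^ k := by
  induction k with
  | zero => simp
  | succ k ih =>
    rw [pow_succ, pow_succ, Nat.divisors_mul]
    exact Finset.card_mul_le.trans (Nat.mul_le_mul_right _ ih)

theorem card_divisors_le_maxDivisors {n i : ℕ} (hi : i ∈ Finset.Icc 1 n) :
    i.divisors.card ≤ maxDivisors n :=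
  Finset.le_sup (f := fun i : ℕ => i.divisors.card) hi

theorem one_le_maxDivisors {n : ℕ} (hn : 1 ≤ n) : 1 ≤ maxDivisors n := by
  simpa using card_divisors_le_maxDivisors (n := n) (i := 1) (by simpa using hn)

theorem tendsto_maxDivisors : Tendsto maxDivisors atTop atTop := by
  refine tendsto_atTop.2 fun b => ?_
  filter_upwards [eventually_ge_atTop (2 ^ b)] with n hn
  have := card_divisors_le_maxDivisors (n := n) (i := 2 ^ b) (by simp [hn, Nat.one_le_two_pow])
  rw [Nat.divisors_prime_pow Nat.prime_two, Finset.card_map, Finset.card_range] at this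
  lia

/-- Compare the factors `a + 1` and `q ^ (ε * a)` prime by prime. For `q ≥ 2 ^ (1 / ε)` the second
is at least `2 ^ a`; each of the boundedly many smaller primes costs a factor `C`. -/
theorem exists_card_divisors_le_rpow {ε : ℝ} (hε : 0 < ε) :
    ∃ C : ℝ, 1 ≤ C ∧ ∀ n : ℕ, n ≠ 0 → (n.divisors.card : ℝ) ≤ C * (n : ℝ) ^ ε := by
  have hl : 0 < Real.log 2 := Real.log_pos one_lt_two
  obtain ⟨C, hC1, hC⟩ : ∃ C : ℝ, 1 ≤ C ∧ 1 ≤ C * (ε * Real.log 2) :=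
    ⟨max 1 (ε * Real.log 2)⁻¹, le_max_left _ _, by
      calc (1 : ℝ) = (ε * Real.log 2)⁻¹ * (ε * Real.log 2) :=
            (inv_mul_cancel₀ (by positivity)).symm
        _ ≤ _ := mul_le_mul_of_nonneg_right (le_max_right _ _) (by positivity)⟩
  obtain ⟨K, hK⟩ := exists_nat_gt ((2 : ℝ) ^ (1 / ε))
  refine ⟨C ^ K, one_le_pow₀ hC1, fun n hn => ?_⟩
  have hn' : (n : ℝ) ^ ε = ∏ q ∈ n.primeFactors, ((q : ℝ) ^ ε) ^ n.factorization q := by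
    conv_lhs => rw [← Nat.prod_factorization_pow_eq_self hn]
    rw [Finsupp.prod, Nat.support_factorization, Nat.cast_prod,
      ← Real.finsetProd_rpow _ _ fun _ _ => by positivity]
    refine Finset.prod_congr rfl fun q _ => ?_
    rw [Nat.cast_pow, ← Real.rpow_natCast, ← Real.rpow_natCast, ← Real.rpow_mul (by positivity),
      ← Real.rpow_mul (by positivity), mul_comm]
  have hCK : ∏ q ∈ n.primeFactors, (if q < K then C else 1) ≤ C ^ K := by
    rw [Finset.prod_ite, Finset.prod_const, Finset.prod_const_one, mul_one]
    refine pow_le_pow_right₀ hC1 ?_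
    calc (n.primeFactors.filter (· < K)).card ≤ (Finset.range K).card :=
          Finset.card_le_card fun q hq => by simpa using (Finset.mem_filter.1 hq).2
      _ = K := Finset.card_range K
  rw [Nat.card_divisors hn, hn']
  push_cast
  refine le_trans ?_ (mul_le_mul_of_nonneg_right hCK (by positivity))
  rw [← Finset.prod_mul_distrib]
  refine Finset.prod_le_prod (fun _ _ => by positivity) fun q hq => ?_
  have hq2 : (2 : ℝ) ≤ q := by exact_mod_cast (Nat.prime_of_mem_primeFactors hq).two_le
  set a := n.factorization q
  split_ifs with hqK
  · have h1 : 1 + a * (ε * Real.log 2) ≤ ((q : ℝ) ^ ε) ^ a := by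
      calc 1 + a * (ε * Real.log 2) ≤ Real.exp (a * (ε * Real.log 2)) := by
            linarith [Real.add_one_le_exp (a * (ε * Real.log 2))]
        _ = ((2 : ℝ) ^ ε) ^ a := by
            rw [Real.rpow_def_of_pos two_pos, ← Real.exp_nat_mul]
            ring_nf
        _ ≤ ((q : ℝ) ^ ε) ^ a :=
            pow_le_pow_left₀ (by positivity) (Real.rpow_le_rpow (by positivity) hq2 hε.le) _
    have h2 : (a : ℝ) * 1 ≤ a * (C * (ε * Real.log 2)) :=
      mul_le_mul_of_nonneg_left hC (by positivity)
    calc (a : ℝ) + 1 ≤ C * (1 + a * (ε * Real.log 2)) := by linarith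
      _ ≤ C * ((q : ℝ) ^ ε) ^ a := mul_le_mul_of_nonneg_left h1 (by linarith)
  · have h1 : (2 : ℝ) ≤ (q : ℝ) ^ ε := by
      calc (2 : ℝ) = ((2 : ℝ) ^ (1 / ε)) ^ ε := by
            rw [← Real.rpow_mul two_pos.le, one_div_mul_cancel hε.ne', Real.rpow_one]
        _ ≤ (q : ℝ) ^ ε := by
            refine Real.rpow_le_rpow (by positivity) (hK.le.trans ?_) hε.le
            exact_mod_cast not_lt.1 hqK
    calc (a : ℝ) + 1 ≤ 2 ^ a := by exact_mod_cast Nat.lt_two_pow_self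
      _ ≤ 1 * ((q : ℝ) ^ ε) ^ a := by
          rw [one_mul]
          exact pow_le_pow_left₀ two_pos.le h1 _

theorem exists_maxDivisors_le_rpow {ε : ℝ} (hε : 0 < ε) :
    ∃ C : ℝ, 1 ≤ C ∧ ∀ n : ℕ, 1 ≤ n → (maxDivisors n : ℝ) ≤ C * (n : ℝ) ^ ε := by
  obtain ⟨C, hC1, hC⟩ := exists_card_divisors_le_rpow hε
  refine ⟨C, hC1, fun n hn => ?_⟩
  obtain ⟨i, hi, hi'⟩ := Finset.exists_mem_eq_sup (Finset.Icc 1 n) ⟨1, by simpa using hn⟩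
    fun i : ℕ => i.divisors.card
  rw [maxDivisors, hi']
  rw [Finset.mem_Icc] at hi
  refine (hC i (by lia)).trans (mul_le_mul_of_nonneg_left ?_ (by linarith))
  exact Real.rpow_le_rpow (by positivity) (by exact_mod_cast hi.2) hε.le

theorem tendsto_log_maxDivisors_div_log :
    Tendsto (fun n : ℕ => Real.log (maxDivisors n) / Real.log n) atTop (𝓝 0) := by
  have hlog : Tendsto (fun n : ℕ => Real.log n) atTop atTop :=
    Real.tendsto_log_atTop.comp tendsto_natCast_atTop_atTop
  rw [Metric.tendsto_nhds]
  intro δ hδ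
  obtain ⟨C, hC1, hC⟩ := exists_maxDivisors_le_rpow (half_pos hδ)
  filter_upwards [eventually_ge_atTop 2, hlog.eventually_gt_atTop (Real.log C / (δ / 2))]
    with n hn hn'
  have hn0 : (0 : ℝ) < n := by positivity
  have hl : 0 < Real.log n := Real.log_pos (by exact_mod_cast hn)
  have hD : (1 : ℝ) ≤ maxDivisors n := by exact_mod_cast one_le_maxDivisors (by lia)
  have h0 : 0 ≤ Real.log (maxDivisors n) := Real.log_nonneg hD
  rw [Real.dist_0_eq_abs, abs_of_nonneg (by positivity), div_lt_iff₀ hl]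
  have h1 : Real.log (maxDivisors n) ≤ Real.log C + δ / 2 * Real.log n := by
    rw [← Real.log_rpow hn0, ← Real.log_mul (by positivity) (by positivity)]
    exact Real.log_le_log (by linarith) (hC n (by lia))
  rw [div_lt_iff₀ (by positivity)] at hn'
  linarith

theorem rpow_mul_inv_maxDivisors_pow {n : ℕ} (hn : 1 ≤ n) :
    (n : ℝ) ^ (-(1 / 9) : ℝ) * ((maxDivisors n : ℝ) ^ 100)⁻¹ =
      (n : ℝ) ^ (-(1 / 9) - 100 * (Real.log (maxDivisors n) / Real.log n) : ℝ) := by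
  rcases hn.eq_or_lt with rfl | hn
  · simp [maxDivisors]
  have hn0 : (0 : ℝ) < n := by positivity
  have hl : 0 < Real.log n := Real.log_pos (by exact_mod_cast hn)
  have hD : (0 : ℝ) < maxDivisors n := by exact_mod_cast one_le_maxDivisors (by lia)
  rw [Real.rpow_sub hn0, div_eq_mul_inv]
  congr 2
  rw [Real.rpow_def_of_pos hn0, show Real.log n * (100 * (Real.log (maxDivisors n) / Real.log n)) =
    (100 : ℕ) * Real.log (maxDivisors n) by push_cast; field_simp, Real.exp_nat_mul,
    Real.exp_log hD]

/-! ### The 0-statement -/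

-- Union bound over violations of sparsity: at most `n ^ (j / 9)` values of `m`, at most `D(n) ^ (9
-- * j)` sets of `j` divisors of `m ^ 9`, each contained with probability at most `p ^ j`.
open MeasureTheory in
theorem probRandomSubset_isProductSchur_le (n : ℕ) (p : unitInterval) :
    probRandomSubset n p IsProductSchur ≤
      ∑ j ∈ Finset.Icc 1 9, ((n : ℝ) ^ (1 / 9 : ℝ) * (maxDivisors n : ℝ) ^ 9 * p) ^ j := by
  classical
  set μ := setBernoulli (Set.Icc 1 n) p
  let Ms : ℕ → Finset ℕ := fun j => (Finset.Icc 1 n).filter fun m => m ^ 9 ≤ n ^ j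
  let Ss : ℕ → ℕ → Finset (Finset ℕ) := fun j m => (m ^ 9).divisors.powersetCard j
  have hsub : {A | IsProductSchur A} ⊆ {A | ¬ A ⊆ Set.Icc 1 n} ∪
      ⋃ j ∈ Finset.Icc 1 9, ⋃ m ∈ Ms j, ⋃ S ∈ Ss j m, {A : Set ℕ | ↑S ⊆ A} := by
    intro A hA
    by_contra hcon
    rw [Set.mem_union, not_or] at hcon
    obtain ⟨h1, h2⟩ := hcon
    refine IsDivisorSparse.not_isProductSchur (n := n) ⟨not_not.1 h1, ?_⟩ hA
    intro j hj m hm hmn S hSA hSm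
    by_contra! hcard
    obtain ⟨S', hS', hS'j⟩ := Finset.exists_subset_card_eq hcard
    refine h2 ?_
    simp only [Set.mem_iUnion]
    refine ⟨j, hj, m, ?_, S', ?_, (Finset.coe_subset.2 hS').trans hSA⟩
    · rw [Finset.mem_Icc] at hj
      have hn : 1 ≤ n := by
        by_contra! h0
        obtain rfl : n = 0 := by lia
        rw [zero_pow (by lia)] at hmn
        have : 0 < m ^ 9 := by positivity
        lia
      have : m ≤ n := by
        refine (Nat.pow_le_pow_iff_left (n := 9) (by norm_num)).1 (hmn.trans ?_)
        exact Nat.pow_le_pow_right hn hj.2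
      simp [Ms, hm, this, hmn]
    · refine Finset.mem_powersetCard.2 ⟨fun x hx => ?_, hS'j⟩
      have : m ^ 9 ≠ 0 := by positivity
      exact Nat.mem_divisors.2 ⟨hSm x (hS' hx), this⟩
  have h0 : μ.real {A | ¬ A ⊆ Set.Icc 1 n} = 0 := by
    have : μ {A | ¬ A ⊆ Set.Icc 1 n} = 0 := setBernoulli_ae_subset
    rw [measureReal_def, this, ENNReal.toReal_zero]
  calc probRandomSubset n p IsProductSchur
      ≤ μ.real ({A | ¬ A ⊆ Set.Icc 1 n} ∪
          ⋃ j ∈ Finset.Icc 1 9, ⋃ m ∈ Ms j, ⋃ S ∈ Ss j m, {A : Set ℕ | ↑S ⊆ A}) :=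
        measureReal_mono hsub
    _ ≤ μ.real (⋃ j ∈ Finset.Icc 1 9, ⋃ m ∈ Ms j, ⋃ S ∈ Ss j m, {A : Set ℕ | ↑S ⊆ A}) := by
        refine (measureReal_union_le _ _).trans ?_
        rw [h0, zero_add]
    _ ≤ ∑ j ∈ Finset.Icc 1 9, ∑ m ∈ Ms j, ∑ S ∈ Ss j m, μ.real {A : Set ℕ | ↑S ⊆ A} := by
        refine (measureReal_biUnion_finset_le _ _).trans (Finset.sum_le_sum fun j _ => ?_)
        refine (measureReal_biUnion_finset_le _ _).trans (Finset.sum_le_sum fun m _ => ?_)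
        exact measureReal_biUnion_finset_le _ _
    _ ≤ ∑ j ∈ Finset.Icc 1 9, ∑ m ∈ Ms j, ((maxDivisors n : ℝ) ^ 9) ^ j * (p : ℝ) ^ j := by
        refine Finset.sum_le_sum fun j _ => Finset.sum_le_sum fun m hm => ?_
        calc ∑ S ∈ Ss j m, μ.real {A : Set ℕ | ↑S ⊆ A} ≤ ∑ S ∈ Ss j m, (p : ℝ) ^ j := by
              refine Finset.sum_le_sum fun S hS => (setBernoulli_real_superset_le S).trans ?_
              rw [(Finset.mem_powersetCard.1 hS).2]
          _ = ((m ^ 9).divisors.card.choose j : ℝ) * (p : ℝ) ^ j := by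
              rw [Finset.sum_const, nsmul_eq_mul, Finset.card_powersetCard]
          _ ≤ ((maxDivisors n : ℝ) ^ 9) ^ j * (p : ℝ) ^ j := by
              refine mul_le_mul_of_nonneg_right ?_ (pow_nonneg p.2.1 _)
              have h1 : (m ^ 9).divisors.card ≤ maxDivisors n ^ 9 :=
                (Nat.card_divisors_pow_le m 9).trans (Nat.pow_le_pow_left
                  (card_divisors_le_maxDivisors (Finset.mem_filter.1 hm).1) 9)
              exact_mod_cast (Nat.choose_le_pow _ _).trans (Nat.pow_le_pow_left h1 j)
    _ ≤ ∑ j ∈ Finset.Icc 1 9, ((n : ℝ) ^ (1 / 9 : ℝ) * (maxDivisors n : ℝ) ^ 9 * p) ^ j := by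
        refine Finset.sum_le_sum fun j _ => ?_
        rw [Finset.sum_const, nsmul_eq_mul, mul_pow, mul_pow, mul_assoc]
        refine mul_le_mul_of_nonneg_right ?_
          (mul_nonneg (by positivity) (pow_nonneg p.2.1 _))
        have h1 : Ms j ⊆ Finset.Icc 1 ⌊((n : ℝ) ^ (1 / 9 : ℝ)) ^ j⌋₊ := by
          intro m hm
          obtain ⟨hm1, hm2⟩ := Finset.mem_filter.1 hm
          refine Finset.mem_Icc.2 ⟨(Finset.mem_Icc.1 hm1).1, Nat.le_floor ?_⟩
          refine (pow_le_pow_iff_left₀ (by positivity) (by positivity)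
            (show (9 : ℕ) ≠ 0 by norm_num)).1 ?_
          rw [pow_right_comm, ← Real.rpow_natCast ((n : ℝ) ^ (1 / 9 : ℝ)) 9,
            ← Real.rpow_mul (by positivity)]
          norm_num
          exact_mod_cast hm2
        calc ((Ms j).card : ℝ) ≤ (⌊((n : ℝ) ^ (1 / 9 : ℝ)) ^ j⌋₊ : ℝ) := by
              exact_mod_cast (Finset.card_le_card h1).trans (by simp)
          _ ≤ _ := Nat.floor_le (by positivity)

theorem tendsto_probRandomSubset_isProductSchur_zero (p : ℕ → unitInterval)
    (hp : ∀ᶠ n : ℕ in atTop,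
      (p n : ℝ) ≤ (n : ℝ) ^ (-(1 / 9) : ℝ) * ((maxDivisors n : ℝ) ^ 100)⁻¹) :
    Tendsto (fun n : ℕ => probRandomSubset n (p n) IsProductSchur) atTop (𝓝 0) := by
  have hlim : Tendsto (fun n : ℕ => 9 * (maxDivisors n : ℝ)⁻¹) atTop (𝓝 0) := by
    simpa using (((tendsto_natCast_atTop_atTop (R := ℝ)).comp
      tendsto_maxDivisors).inv_tendsto_atTop).const_mul 9
  refine squeeze_zero' (.of_forall fun n => MeasureTheory.measureReal_nonneg) ?_ hlim
  filter_upwards [hp, eventually_ge_atTop 1] with n hpn hn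
  have hn0 : (0 : ℝ) < n := by positivity
  have hD : (1 : ℝ) ≤ maxDivisors n := by exact_mod_cast one_le_maxDivisors hn
  set D : ℝ := (maxDivisors n : ℝ)
  -- The exponent 100 is generous: the union bound loses `D ^ 9`, and one more factor `D` makes the
  -- bound tend to 0.
  have hx : (n : ℝ) ^ (1 / 9 : ℝ) * D ^ 9 * p n ≤ D⁻¹ := by
    calc (n : ℝ) ^ (1 / 9 : ℝ) * D ^ 9 * p n
        ≤ (n : ℝ) ^ (1 / 9 : ℝ) * D ^ 9 * ((n : ℝ) ^ (-(1 / 9) : ℝ) * (D ^ 100)⁻¹) :=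
          mul_le_mul_of_nonneg_left hpn (by positivity)
      _ = D ^ 9 * (D ^ 100)⁻¹ := by
          rw [Real.rpow_neg hn0.le]
          field_simp
      _ ≤ D⁻¹ := by
          rw [← div_eq_mul_inv, inv_eq_one_div, div_le_div_iff₀ (by positivity) (by positivity),
            one_mul, ← pow_succ]
          exact pow_le_pow_right₀ hD (by norm_num)
  have hx0 : 0 ≤ (n : ℝ) ^ (1 / 9 : ℝ) * D ^ 9 * p n :=
    mul_nonneg (by positivity) (p n).2.1
  have hD1 : D⁻¹ ≤ 1 := inv_le_one_of_one_le₀ hD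
  calc probRandomSubset n (p n) IsProductSchur
      ≤ ∑ j ∈ Finset.Icc 1 9, ((n : ℝ) ^ (1 / 9 : ℝ) * D ^ 9 * p n) ^ j :=
        probRandomSubset_isProductSchur_le n (p n)
    _ ≤ ∑ j ∈ Finset.Icc 1 9, D⁻¹ := by
        refine Finset.sum_le_sum fun j hj => ?_
        refine (pow_le_of_le_one hx0 (hx.trans hD1) ?_).trans hx
        have := (Finset.mem_Icc.1 hj).1
        lia
    _ = 9 * D⁻¹ := by simp

/-! ### The 1-statement -/

theorem IsNondegProductSchur.isProductSchur {A : Set ℕ} (h : IsNondegProductSchur A) :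
    IsProductSchur A := fun χ => by
  obtain ⟨a, b, c, habc, -, h1, h2⟩ := h χ
  exact ⟨a, b, c, habc, h1, h2⟩

/-- Let `a`, `b` be red, so `ab` is blue. If `c` is red, then `bc` is blue, `abbc` red, `abc` blue,
and `aabbc` can have neither colour. If `c` is blue, then `abc` is red, `bc` blue, and `abbc` can
have neither colour. -/
theorem ne_of_forall_not_monochromatic (a b ab c bc abc abbc aabbc : Fin 2)
    (h1 : ¬ (a = b ∧ b = ab)) (h2 : ¬ (b = c ∧ c = bc)) (h3 : ¬ (a = bc ∧ bc = abc))
    (h4 : ¬ (ab = c ∧ c = abc)) (h5 : ¬ (b = abc ∧ abc = abbc)) (h6 : ¬ (ab = bc ∧ bc = abbc))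
    (h7 : ¬ (ab = abc ∧ abc = aabbc)) (h8 : ¬ (a = abbc ∧ abbc = aabbc)) : a ≠ b := by
  lia

/-- The pattern is symmetric in `a` and `b`, so if they differ, let `a`, `d` be red and `b` blue.
Then `ad` is blue, `abd` red, `aabd` blue, so `ab` is red, and `ab`, `d`, `abd` are all red. -/
theorem eq_of_forall_not_monochromatic (a b ab d ad bd abd aabd abbd : Fin 2)
    (h2 : ¬ (a = d ∧ d = ad)) (h3 : ¬ (b = d ∧ d = bd))
    (h4 : ¬ (ab = d ∧ d = abd)) (h5 : ¬ (a = bd ∧ bd = abd)) (h6 : ¬ (b = ad ∧ ad = abd))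
    (h7 : ¬ (a = abd ∧ abd = aabd)) (h8 : ¬ (ab = ad ∧ ad = aabd))
    (h9 : ¬ (b = abd ∧ abd = abbd)) (h10 : ¬ (ab = bd ∧ bd = abbd)) : a = b := by
  omega

/-- The multiples of `c` exclude equal colours of `a` and `b`, those of `d` exclude different ones.
The size conditions make the two factors distinct in every product used. -/
theorem isNondegProductSchur_of_subset {A : Set ℕ} {a b c d : ℕ} (hba : b < a) (hb : 1 ≤ b)
    (hc : a * b < c) (hd : a * b < d)
    (h : {b, a, b * a} ⊆ A)
    (hcA : {c, b * c, b * a * c, b ^ 2 * a * c, b ^ 2 * a ^ 2 * c} ⊆ A)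
    (hdA : {d, b * d, a * d, b * a * d, b ^ 2 * a * d, b * a ^ 2 * d} ⊆ A) :
    IsNondegProductSchur A := by
  simp only [Set.insert_subset_iff, Set.singleton_subset_iff] at h hcA hdA
  obtain ⟨hb', ha', hab⟩ := h
  obtain ⟨hc1, hc2, hc3, hc4, hc5⟩ := hcA
  obtain ⟨hd1, hd2, hd3, hd4, hd5, hd6⟩ := hdA
  intro χ
  by_contra! hcon
  have key : ∀ (x y z : A), (x : ℕ) * y = z → (x : ℕ) < y ∨ (y : ℕ) < x →
      ¬ (χ x = χ y ∧ χ y = χ z) := by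
    intro x y z hxyz hne hχ
    exact hcon x y z hxyz (fun hh => by rw [hh] at hne; lia) hχ.1 hχ.2
  have hle : ∀ {s t : ℕ}, 1 ≤ s → t ≤ s * t := fun {s t} hs => Nat.le_mul_of_pos_left t hs
  have hab1 : b * a = a * b := mul_comm b a
  have hab2 : a ≤ b * a := hle hb
  have m1 : 1 ≤ b * a := by nlinarith
  have m2 : 1 ≤ b ^ 2 * a := by nlinarith
  have c2 : c ≤ b * c := hle hb
  have c3 : b * c < b * a * c := by nlinarith
  have c4 : b * a * c ≤ b ^ 2 * a * c := by nlinarith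
  have d2 : d ≤ b * d := hle hb
  have d3 : b * d < a * d := by nlinarith
  have d4 : a * d ≤ b * a * d := by nlinarith
  refine ne_of_forall_not_monochromatic (χ ⟨a, ha'⟩) (χ ⟨b, hb'⟩) (χ ⟨_, hab⟩) (χ ⟨_, hc1⟩)
    (χ ⟨_, hc2⟩) (χ ⟨_, hc3⟩) (χ ⟨_, hc4⟩) (χ ⟨_, hc5⟩) ?_ ?_ ?_ ?_ ?_ ?_ ?_ ?_
    (eq_of_forall_not_monochromatic (χ ⟨a, ha'⟩) (χ ⟨b, hb'⟩) (χ ⟨_, hab⟩) (χ ⟨_, hd1⟩)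
    (χ ⟨_, hd3⟩) (χ ⟨_, hd2⟩) (χ ⟨_, hd4⟩) (χ ⟨_, hd6⟩) (χ ⟨_, hd5⟩) ?_ ?_ ?_ ?_ ?_ ?_ ?_ ?_ ?_)
  all_goals refine key _ _ _ ?_ ?_
  all_goals dsimp only
  all_goals first | ring1 | lia

/-! ### Searching for a dilate of a fixed pattern. -/

/-- The family of sets containing `S`, but none of the dilates `c • D` with `X ≤ c < 2 * X`. -/
def noDilate (S D : Finset ℕ) (X : ℕ) : Set (Set ℕ) :=
  {A | ↑S ⊆ A ∧ ∀ c ∈ Finset.Ico X (2 * X), ¬ ↑(D.image (· * c)) ⊆ A}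

-- Multipliers in `D` differ by factors of at least 2, while two values of `c` differ by a factor
-- below 2. Hence the `X` dilates are pairwise disjoint, and they lie above `S`: this gives `X`
-- independent trials, each succeeding with probability at least `p ^ k`.
open MeasureTheory in
theorem setBernoulli_real_noDilate_le {n X k : ℕ} {p : unitInterval}
    {S D : Finset ℕ} (hSn : ↑S ⊆ Set.Icc 1 n) (hSX : ∀ s ∈ S, s < X) (hD1 : ∀ m ∈ D, 1 ≤ m)
    (hDn : ∀ m ∈ D, m * (2 * X) ≤ n) (hD : ∀ m ∈ D, ∀ m' ∈ D, m < m' → 2 * m ≤ m')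
    (hk : D.card ≤ k) :
    (setBernoulli (Set.Icc 1 n) p).real (noDilate S D X) ≤
      (p : ℝ) ^ S.card * Real.exp (-((p : ℝ) ^ k * X)) := by
  classical
  have key : ∀ c ∈ Finset.Ico X (2 * X), ∀ c' ∈ Finset.Ico X (2 * X), ∀ m ∈ D, ∀ m' ∈ D,
      m < m' → m * c ≠ m' * c' := by
    intro c hc c' hc' m hm m' hm' hlt he
    rw [Finset.mem_Ico] at hc hc'
    have h1 := hD m hm m' hm' hlt
    have h2 := hD1 m hm
    nlinarith
  have h := setBernoulli_real_superset_inter_le (p := p) (u := Set.Icc 1 n)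
    (Finset.Ico X (2 * X)) (fun c => D.image (· * c)) ?_ ?_ S hSn ?_ (k := k) ?_
  · have hcard : (Finset.Ico X (2 * X)).card = X := by rw [Nat.card_Ico]; lia
    rwa [hcard] at h
  · intro c hc x hx
    obtain ⟨m, hm, rfl⟩ := Finset.mem_image.1 (Finset.mem_coe.1 hx)
    rw [Finset.mem_Ico] at hc
    have h1 := hD1 m hm
    have h2 := hDn m hm
    refine ⟨Nat.mul_pos h1 ?_, (Nat.mul_le_mul_left m hc.2.le).trans h2⟩
    lia
  · intro c hc c' hc' hne
    refine Finset.disjoint_left.2 fun x hx hx' => ?_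
    obtain ⟨m, hm, rfl⟩ := Finset.mem_image.1 hx
    obtain ⟨m', hm', he⟩ := Finset.mem_image.1 hx'
    rcases lt_trichotomy m m' with hlt | rfl | hlt
    · exact key c hc c' hc' m hm m' hm' hlt he.symm
    · exact hne (Nat.eq_of_mul_eq_mul_left (hD1 m hm) he).symm
    · exact key c' hc' c hc m' hm' m hm hlt he
  · intro c hc
    refine Finset.disjoint_left.2 fun x hx hx' => ?_
    obtain ⟨m, hm, rfl⟩ := Finset.mem_image.1 hx'
    have h1 := hSX _ hx
    have h2 := hD1 m hm
    rw [Finset.mem_Ico] at hc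
    nlinarith
  · exact fun c _ => Finset.card_image_le.trans hk

/-- The sizes of the elements of the configuration: `b ∼ N` and `a ∼ N ^ 2`. -/
structure IsSeed (N b a : ℕ) : Prop where
  four_le : 4 ≤ N
  left : b ∈ Finset.Ico N (2 * N)
  right : a ∈ Finset.Ico (N ^ 2) (2 * N ^ 2)

namespace IsSeed

variable {n N b a : ℕ}

theorem four_le_left (h : IsSeed N b a) : 4 ≤ b :=
  h.four_le.trans (Finset.mem_Ico.1 h.left).1

theorem two_mul_left_le (h : IsSeed N b a) : 2 * b ≤ a := by
  have h1 := (Finset.mem_Ico.1 h.left).2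
  have h2 := (Finset.mem_Ico.1 h.right).1
  have h3 := h.four_le
  nlinarith

theorem right_lt_mul (h : IsSeed N b a) : a < b * a := by
  have := h.four_le_left
  have := h.two_mul_left_le
  nlinarith

theorem mul_lt (h : IsSeed N b a) : b * a < N ^ 5 := by
  calc b * a < (2 * N) * (2 * N ^ 2) :=
        Nat.mul_lt_mul'' (Finset.mem_Ico.1 h.left).2 (Finset.mem_Ico.1 h.right).2
    _ = 4 * N ^ 3 := by ring
    _ ≤ N ^ 2 * N ^ 3 := Nat.mul_le_mul_right _ (by nlinarith [h.four_le])
    _ = N ^ 5 := by ring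

theorem lt_of_mem (h : IsSeed N b a) : ∀ s ∈ ({b, a, b * a} : Finset ℕ), s < N ^ 5 := by
  have := h.four_le_left
  have := h.two_mul_left_le
  have := h.right_lt_mul
  have := h.mul_lt
  simp; lia

theorem card_eq (h : IsSeed N b a) : ({b, a, b * a} : Finset ℕ).card = 3 := by
  have := h.four_le_left
  have := h.two_mul_left_le
  have := h.right_lt_mul
  rw [Finset.card_insert_of_notMem, Finset.card_insert_of_notMem, Finset.card_singleton]
  all_goals simp; lia

theorem subset_Icc (h : IsSeed N b a) (hn : 32 * N ^ 11 ≤ n) :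
    ↑({b, a, b * a} : Finset ℕ) ⊆ Set.Icc 1 n := by
  intro x hx
  have h1 := h.lt_of_mem x (by simpa using hx)
  have h2 : N ^ 5 ≤ N ^ 11 := Nat.pow_le_pow_right (by have := h.four_le; lia) (by norm_num)
  have := h.four_le_left
  have := h.two_mul_left_le
  have := h.right_lt_mul
  refine ⟨?_, by lia⟩
  simp at hx; lia

theorem two_mul_mul_le (h : IsSeed N b a) : 2 * (b * a) ≤ b ^ 2 * a := by
  calc 2 * (b * a) ≤ b * (b * a) := Nat.mul_le_mul_right _ (by have := h.four_le_left; lia)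
    _ = b ^ 2 * a := by ring

open MeasureTheory in
theorem setBernoulli_real_noDilate_five_le (h : IsSeed N b a) (hn : 32 * N ^ 11 ≤ n)
    (p : unitInterval) : (setBernoulli (Set.Icc 1 n) p).real
      (noDilate {b, a, b * a} {1, b, b * a, b ^ 2 * a, b ^ 2 * a ^ 2} (N ^ 5)) ≤
      (p : ℝ) ^ 3 * Real.exp (-(p * N : ℝ) ^ 5) := by
  have e1 := h.four_le_left
  have e2 := h.two_mul_left_le
  have e3 := h.right_lt_mul
  have m1 := h.two_mul_mul_le
  have m2 : 2 * (b ^ 2 * a) ≤ b ^ 2 * a ^ 2 := by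
    calc 2 * (b ^ 2 * a) ≤ a * (b ^ 2 * a) := Nat.mul_le_mul_right _ (by lia)
      _ = b ^ 2 * a ^ 2 := by ring
  have hbig : ∀ m ≤ b ^ 2 * a ^ 2, m * (2 * N ^ 5) ≤ n := fun m hm => by
    refine le_trans ?_ hn
    calc m * (2 * N ^ 5) ≤ (2 * N) ^ 2 * (2 * N ^ 2) ^ 2 * (2 * N ^ 5) :=
          Nat.mul_le_mul_right _ (hm.trans (Nat.mul_le_mul
            (Nat.pow_le_pow_left (Finset.mem_Ico.1 h.left).2.le 2)
            (Nat.pow_le_pow_left (Finset.mem_Ico.1 h.right).2.le 2)))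
      _ = 32 * N ^ 11 := by ring
  -- From here only the chain of multipliers, each at least twice the one before, matters.
  generalize b ^ 2 * a ^ 2 = r at *
  generalize b ^ 2 * a = s at *
  refine (setBernoulli_real_noDilate_le (k := 5) (h.subset_Icc hn) h.lt_of_mem ?_ ?_ ?_
    Finset.card_le_five).trans_eq ?_
  · simp only [Finset.mem_insert, Finset.mem_singleton]
    lia
  · intro m hm
    refine hbig m ?_
    simp only [Finset.mem_insert, Finset.mem_singleton] at hm
    lia
  · generalize b * a = t at *
    simp only [Finset.mem_insert, Finset.mem_singleton]
    rintro m (rfl | rfl | rfl | rfl | rfl) m' (rfl | rfl | rfl | rfl | rfl) <;> lia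
  · rw [h.card_eq, mul_pow, Nat.cast_pow]

open MeasureTheory in
theorem setBernoulli_real_noDilate_six_le (h : IsSeed N b a) (hn : 32 * N ^ 11 ≤ n)
    (p : unitInterval) : (setBernoulli (Set.Icc 1 n) p).real
      (noDilate {b, a, b * a} {1, b, a, b * a, b ^ 2 * a, b * a ^ 2} (N ^ 6)) ≤
      (p : ℝ) ^ 3 * Real.exp (-(p * N : ℝ) ^ 6) := by
  have e1 := h.four_le_left
  have e2 := h.two_mul_left_le
  have e3 : 2 * a ≤ b * a := Nat.mul_le_mul_right _ (by lia)
  have m1 := h.two_mul_mul_le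
  have m2 : 2 * (b ^ 2 * a) ≤ b * a ^ 2 := by
    calc 2 * (b ^ 2 * a) = (2 * b) * (b * a) := by ring
      _ ≤ a * (b * a) := Nat.mul_le_mul_right _ e2
      _ = b * a ^ 2 := by ring
  have hbig : ∀ m ≤ b * a ^ 2, m * (2 * N ^ 6) ≤ n := fun m hm => by
    refine le_trans ?_ hn
    calc m * (2 * N ^ 6) ≤ 2 * N * (2 * N ^ 2) ^ 2 * (2 * N ^ 6) :=
          Nat.mul_le_mul_right _ (hm.trans (Nat.mul_le_mul (Finset.mem_Ico.1 h.left).2.le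
            (Nat.pow_le_pow_left (Finset.mem_Ico.1 h.right).2.le 2)))
      _ = 16 * N ^ 11 := by ring
      _ ≤ 32 * N ^ 11 := Nat.mul_le_mul_right _ (by norm_num)
  have hN6 : N ^ 5 ≤ N ^ 6 := Nat.pow_le_pow_right (by have := h.four_le; lia) (by norm_num)
  generalize b * a ^ 2 = r at *
  generalize b ^ 2 * a = s at *
  refine (setBernoulli_real_noDilate_le (k := 6) (h.subset_Icc hn)
    (fun s hs => (h.lt_of_mem s hs).trans_le hN6) ?_ ?_ ?_ Finset.card_le_six).trans_eq ?_
  · simp only [Finset.mem_insert, Finset.mem_singleton]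
    lia
  · intro m hm
    refine hbig m ?_
    simp only [Finset.mem_insert, Finset.mem_singleton] at hm
    lia
  · generalize b * a = t at *
    simp only [Finset.mem_insert, Finset.mem_singleton]
    rintro m (rfl | rfl | rfl | rfl | rfl | rfl) m' (rfl | rfl | rfl | rfl | rfl | rfl) <;> lia
  · rw [h.card_eq, mul_pow, Nat.cast_pow]

end IsSeed

/-- The configuration is sought in the order `b`, `a`, then `c` and `d`; a set without one must fail
at some stage, and each failure is a `noDilate` event. -/
theorem not_isNondegProductSchur_subset {N : ℕ} (hN : 4 ≤ N) :
    {A | ¬ IsNondegProductSchur A} ⊆ noDilate ∅ {1} N ∪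
      ((⋃ b ∈ Finset.Ico N (2 * N), noDilate {b} {1, b} (N ^ 2)) ∪
      ⋃ b ∈ Finset.Ico N (2 * N), ⋃ a ∈ Finset.Ico (N ^ 2) (2 * N ^ 2),
        (noDilate {b, a, b * a} {1, b, b * a, b ^ 2 * a, b ^ 2 * a ^ 2} (N ^ 5) ∪
          noDilate {b, a, b * a} {1, b, a, b * a, b ^ 2 * a, b * a ^ 2} (N ^ 6))) := by
  intro A hA
  by_contra hcon
  simp only [Set.mem_union, Set.mem_iUnion, not_or, not_exists] at hcon
  obtain ⟨h1, h2, h3⟩ := hcon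
  refine hA ?_
  simp only [noDilate, Set.mem_ofPred_eq, not_and, not_forall, not_not, Finset.coe_image]
    at h1 h2 h3
  obtain ⟨b, hb, hbA⟩ := h1 (by simp)
  have hbA' : b ∈ A := by simpa using hbA
  obtain ⟨a, ha, haA⟩ := h2 b hb (by simpa using hbA')
  have habA : a ∈ A ∧ b * a ∈ A := by simpa [Set.insert_subset_iff, Set.image_insert_eq] using haA
  have hS : (↑({b, a, b * a} : Finset ℕ) : Set ℕ) ⊆ A := by
    simp [Set.insert_subset_iff, hbA', habA]
  obtain ⟨h3c, h3d⟩ := h3 b hb a ha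
  obtain ⟨c, hc, hcA⟩ := h3c hS
  obtain ⟨d, hd, hdA⟩ := h3d hS
  have h : IsSeed N b a := ⟨hN, hb, ha⟩
  have e1 := h.four_le_left
  have e2 := h.two_mul_left_le
  have e3 := h.mul_lt
  have e4 : N ^ 5 ≤ N ^ 6 := Nat.pow_le_pow_right (by lia) (by norm_num)
  rw [Finset.mem_Ico] at hc hd
  refine isNondegProductSchur_of_subset (a := a) (b := b) (c := c) (d := d) (by lia) (by lia)
    (by lia) (by lia) (by simpa using hS) ?_ ?_
  · simpa only [Finset.coe_insert, Finset.coe_singleton, Set.image_insert_eq,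
      Set.image_singleton, one_mul] using hcA
  · simpa only [Finset.coe_insert, Finset.coe_singleton, Set.image_insert_eq,
      Set.image_singleton, one_mul] using hdA

-- The `N` choices of `b` and `N ^ 3` choices of `(b, a)` are paid for by the factors `p` and `p ^
-- 3`, the probability that the seed itself is present. The union bound therefore costs only a power
-- of `p * N`, which the exponentials beat.
open MeasureTheory in
theorem setBernoulli_real_not_isNondegProductSchur_le {n N : ℕ} (hN : 4 ≤ N)
    (hn : 32 * N ^ 11 ≤ n) (p : unitInterval) :
    (setBernoulli (Set.Icc 1 n) p).real {A | ¬ IsNondegProductSchur A} ≤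
      Real.exp (-(p * N)) + p * N * Real.exp (-(p * N : ℝ) ^ 2) +
        (p * N : ℝ) ^ 3 * (Real.exp (-(p * N : ℝ) ^ 5) + Real.exp (-(p * N : ℝ) ^ 6)) := by
  classical
  set μ := setBernoulli (Set.Icc 1 n) p
  set I := Finset.Ico N (2 * N) with hI
  set J := Finset.Ico (N ^ 2) (2 * N ^ 2) with hJ
  have hIcard : I.card = N := by rw [hI, Nat.card_Ico]; lia
  have hJcard : J.card = N ^ 2 := by rw [hJ, Nat.card_Ico]; lia
  have hNn : ∀ k ≤ 11, 32 * N ^ k ≤ n := fun k hk =>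
    (Nat.mul_le_mul_left _ (Nat.pow_le_pow_right (by lia) hk)).trans hn
  have hQ0 : μ.real (noDilate ∅ {1} N) ≤ Real.exp (-(p * N)) := by
    refine (setBernoulli_real_noDilate_le (k := 1) (by simp) (by simp) (by simp) ?_ (by simp)
      (by simp)).trans_eq (by simp)
    have := hNn 1 (by simp)
    simp; lia
  have hQ1 : ∀ b ∈ I, μ.real (noDilate {b} {1, b} (N ^ 2)) ≤
      p * Real.exp (-(p * N : ℝ) ^ 2) := by
    intro b hb
    rw [hI, Finset.mem_Ico] at hb
    refine (setBernoulli_real_noDilate_le (k := 2) ?_ ?_ ?_ ?_ ?_ Finset.card_le_two).trans_eq ?_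
    · have := hNn 1 (by simp)
      simp; lia
    · have : 4 * N ≤ N ^ 2 := by nlinarith
      simp; lia
    · simp; lia
    · have h1 : b * (2 * N ^ 2) ≤ 2 * N * (2 * N ^ 2) := Nat.mul_le_mul_right _ hb.2.le
      have h2 := hNn 3 (by simp)
      have h3 := hNn 2 (by simp)
      have h4 : 2 * N * (2 * N ^ 2) = 4 * N ^ 3 := by ring
      simp; lia
    · simp; lia
    · rw [Finset.card_singleton, pow_one, mul_pow, Nat.cast_pow]
  calc μ.real {A | ¬ IsNondegProductSchur A} ≤ _ :=
        measureReal_mono (not_isNondegProductSchur_subset hN)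
    _ ≤ Real.exp (-(p * N)) + (∑ b ∈ I, p * Real.exp (-(p * N : ℝ) ^ 2) +
          ∑ b ∈ I, ∑ a ∈ J, ((p : ℝ) ^ 3 * Real.exp (-(p * N : ℝ) ^ 5) +
            (p : ℝ) ^ 3 * Real.exp (-(p * N : ℝ) ^ 6))) := by
        refine (measureReal_union_le _ _).trans (add_le_add hQ0 ?_)
        refine (measureReal_union_le _ _).trans (add_le_add ?_ ?_)
        · exact (measureReal_biUnion_finset_le _ _).trans (Finset.sum_le_sum hQ1)
        refine (measureReal_biUnion_finset_le _ _).trans (Finset.sum_le_sum fun b hb => ?_)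
        refine (measureReal_biUnion_finset_le _ _).trans (Finset.sum_le_sum fun a ha => ?_)
        have h : IsSeed N b a := ⟨hN, hb, ha⟩
        exact (measureReal_union_le _ _).trans (add_le_add
          (h.setBernoulli_real_noDilate_five_le hn p) (h.setBernoulli_real_noDilate_six_le hn p))
    _ = _ := by
        simp only [Finset.sum_const, hIcard, hJcard, nsmul_eq_mul]
        push_cast
        ring

theorem tendsto_probRandomSubset_isNondegProductSchur_one (p : ℕ → unitInterval)
    (hp : Tendsto (fun n : ℕ => (p n : ℝ) / (n : ℝ) ^ (-(1 / 11) : ℝ)) atTop atTop) :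
    Tendsto (fun n : ℕ => probRandomSubset n (p n) IsNondegProductSchur) atTop (𝓝 1) := by
  -- The largest `N` with `32 * N ^ 11 ≤ n`; the 32 collects the factors 2 from the dyadic ranges of
  -- `b`, `a` and `c`.
  let N : ℕ → ℕ := fun n => ⌊((n : ℝ) / 32) ^ (1 / 11 : ℝ)⌋₊
  let y : ℕ → ℝ := fun n => p n * N n
  have hroot : Tendsto (fun n : ℕ => (n : ℝ) ^ (1 / 11 : ℝ)) atTop atTop :=
    (tendsto_rpow_atTop (by norm_num)).comp tendsto_natCast_atTop_atTop
  have hNge : ∀ᶠ n : ℕ in atTop, (n : ℝ) ^ (1 / 11 : ℝ) / 4 ≤ N n := by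
    filter_upwards [hroot.eventually_ge_atTop 4] with n hn
    have h1 : (n : ℝ) ^ (1 / 11 : ℝ) / 2 ≤ ((n : ℝ) / 32) ^ (1 / 11 : ℝ) := by
      rw [Real.div_rpow (by positivity) (by norm_num)]
      refine div_le_div_of_nonneg_left (by positivity) (by positivity) ?_
      calc (32 : ℝ) ^ (1 / 11 : ℝ) ≤ ((2 : ℝ) ^ (11 : ℝ)) ^ (1 / 11 : ℝ) :=
            Real.rpow_le_rpow (by norm_num) (by norm_num) (by norm_num)
        _ = 2 := by rw [← Real.rpow_mul (by norm_num)]; norm_num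
    have h2 := Nat.lt_floor_add_one (((n : ℝ) / 32) ^ (1 / 11 : ℝ))
    change _ < (N n : ℝ) + 1 at h2
    linarith
  have hy : Tendsto y atTop atTop := by
    refine tendsto_atTop_mono' atTop ?_ (hp.atTop_div_const (show (0 : ℝ) < 4 by norm_num))
    filter_upwards [hNge, eventually_ge_atTop 1] with n hn hn1
    have hn0 : (0 : ℝ) < n := by positivity
    rw [Real.rpow_neg hn0.le, div_inv_eq_mul, mul_div_assoc]
    exact mul_le_mul_of_nonneg_left hn (p n).2.1
  have hlim : Tendsto (fun n => y n ^ 0 * Real.exp (-y n) + y n ^ 1 * Real.exp (-y n) +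
      2 * (y n ^ 3 * Real.exp (-y n))) atTop (𝓝 0) := by
    have h := fun k : ℕ => (Real.tendsto_pow_mul_exp_neg_atTop_nhds_zero k).comp hy
    simpa using ((h 0).add (h 1)).add ((h 3).const_mul 2)
  have hfail : ∀ᶠ n : ℕ in atTop, 1 - (y n ^ 0 * Real.exp (-y n) + y n ^ 1 * Real.exp (-y n) +
      2 * (y n ^ 3 * Real.exp (-y n))) ≤ probRandomSubset n (p n) IsNondegProductSchur := by
    filter_upwards [hNge, hroot.eventually_ge_atTop 16, hy.eventually_ge_atTop 1] with n h1 h2 h3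
    have hN4 : 4 ≤ N n := by
      have : (4 : ℝ) ≤ N n := by linarith
      exact_mod_cast this
    have hNn : 32 * N n ^ 11 ≤ n := by
      have h4 : (N n : ℝ) ≤ ((n : ℝ) / 32) ^ (1 / 11 : ℝ) := Nat.floor_le (by positivity)
      have h5 : (N n : ℝ) ^ 11 ≤ (n : ℝ) / 32 := by
        calc (N n : ℝ) ^ 11 ≤ (((n : ℝ) / 32) ^ (1 / 11 : ℝ)) ^ 11 :=
              pow_le_pow_left₀ (by positivity) h4 _
          _ = (n : ℝ) / 32 := by
              rw [← Real.rpow_natCast, ← Real.rpow_mul (by positivity)]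
              norm_num
      have h6 : (32 : ℝ) * (N n : ℝ) ^ 11 ≤ n := by linarith
      exact_mod_cast h6
    have hbound := setBernoulli_real_not_isNondegProductSchur_le hN4 hNn (p n)
    change _ ≤ Real.exp (-y n) + y n * Real.exp (-y n ^ 2) +
      y n ^ 3 * (Real.exp (-y n ^ 5) + Real.exp (-y n ^ 6)) at hbound
    have hexp : ∀ k : ℕ, k ≠ 0 → Real.exp (-y n ^ k) ≤ Real.exp (-y n) := fun k hk =>
      Real.exp_le_exp.2 (neg_le_neg (le_self_pow₀ h3 hk))
    have h7 : y n * Real.exp (-y n ^ 2) ≤ y n * Real.exp (-y n) :=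
      mul_le_mul_of_nonneg_left (hexp 2 two_ne_zero) (by linarith)
    have h8 : y n ^ 3 * (Real.exp (-y n ^ 5) + Real.exp (-y n ^ 6)) ≤
        y n ^ 3 * (Real.exp (-y n) + Real.exp (-y n)) :=
      mul_le_mul_of_nonneg_left (add_le_add (hexp 5 (by norm_num)) (hexp 6 (by norm_num)))
        (by positivity)
    -- Subadditivity alone suffices here, so measurability of the event plays no role.
    have h9 : (1 : ℝ) ≤ probRandomSubset n (p n) IsNondegProductSchur +
        (setBernoulli (Set.Icc 1 n) (p n)).real {A | ¬ IsNondegProductSchur A} := by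
      have := MeasureTheory.measureReal_union_le (μ := setBernoulli (Set.Icc 1 n) (p n))
        {A | IsNondegProductSchur A} {A | ¬ IsNondegProductSchur A}
      rwa [show {A | IsNondegProductSchur A} ∪ {A | ¬ IsNondegProductSchur A} = Set.univ from
        Set.union_compl_self _, MeasureTheory.probReal_univ] at this
    rw [pow_zero, pow_one, one_mul]
    linarith
  refine tendsto_of_tendsto_of_tendsto_of_le_of_le' (by simpa using hlim.const_sub 1)
    tendsto_const_nhds hfail (.of_forall fun n => MeasureTheory.measureReal_le_one)

theorem probRandomSubset_mono {n : ℕ} {p : unitInterval} {P Q : Set ℕ → Prop}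
    (h : ∀ A, P A → Q A) : probRandomSubset n p P ≤ probRandomSubset n p Q :=
  MeasureTheory.measureReal_mono fun A hA => h A hA

theorem theorem1p2 :
    -- the 0-statement, with an explicit bound
    (∀ p : ℕ → unitInterval,
      (∀ᶠ n : ℕ in atTop,
        (p n : ℝ) ≤ (n : ℝ) ^ (-(1 / 9) : ℝ) * ((maxDivisors n : ℝ) ^ 100)⁻¹) →
      Tendsto (fun n : ℕ => probRandomSubset n (p n) IsProductSchur) atTop (𝓝 0)) ∧
    -- the bound is of the form `n ^ (-1/9 - o(1))`, and the 0-statement in that form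
    (∃ ε : ℕ → ℝ, Tendsto ε atTop (𝓝 0) ∧
      (∀ n : ℕ, 1 ≤ n →
        (n : ℝ) ^ (-(1 / 9) : ℝ) * ((maxDivisors n : ℝ) ^ 100)⁻¹ =
          (n : ℝ) ^ (-(1 / 9) - ε n : ℝ)) ∧
      ∀ p : ℕ → unitInterval,
        (∀ᶠ n : ℕ in atTop, (p n : ℝ) ≤ (n : ℝ) ^ (-(1 / 9) - ε n : ℝ)) →
        Tendsto (fun n : ℕ => probRandomSubset n (p n) IsProductSchur) atTop (𝓝 0)) ∧
    -- the 1-statement, also with non-degenerate products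
    (∀ p : ℕ → unitInterval,
      Tendsto (fun n : ℕ => (p n : ℝ) / (n : ℝ) ^ (-(1 / 11) : ℝ)) atTop atTop →
      Tendsto (fun n : ℕ => probRandomSubset n (p n) IsProductSchur) atTop (𝓝 1) ∧
      Tendsto (fun n : ℕ => probRandomSubset n (p n) IsNondegProductSchur) atTop (𝓝 1)) := by
  refine ⟨tendsto_probRandomSubset_isProductSchur_zero,
    ⟨fun n => 100 * (Real.log (maxDivisors n) / Real.log n), ?_,
      fun n hn => rpow_mul_inv_maxDivisors_pow hn, fun p hp => ?_⟩, fun p hp => ?_⟩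
  · simpa using tendsto_log_maxDivisors_div_log.const_mul 100
  · refine tendsto_probRandomSubset_isProductSchur_zero p ?_
    filter_upwards [hp, eventually_ge_atTop 1] with n hn hn1
    rwa [rpow_mul_inv_maxDivisors_pow hn1]
  · have h := tendsto_probRandomSubset_isNondegProductSchur_one p hp
    refine ⟨?_, h⟩
    exact tendsto_of_tendsto_of_tendsto_of_le_of_le h tendsto_const_nhds
      (fun n => probRandomSubset_mono fun A hA => hA.isProductSchur)
      (fun n => MeasureTheory.measureReal_le_one)
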